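/- Let $b>0$ and $a^*>0$, and let $G_0,G_1:[0,a^*]\to\mathbb R$ be bounded measurable functions with $4\pi\le G_0(a)<G_1(a)$ for almost every $a$. For $z\in[0,1]$ put $\delta G=G_1-G_0$, $G_z=(1-z)G_0+zG_1$ and $$\kappa(z)=\kappa_1(b,G_z):=\inf\left\{\frac{\int_0^{a^*}\left(aG_z(a)|f'(a)|^2+\frac{b^2a}{G_z(a)}|f(a)|^2\right)da}{|f(a^*)|^2}\;:\; f\in L^2(0,a^*),\ f'\in L^2((0,a^*);aG_z(a)\,da),\ f(a^*)\ne0\right\},$$ where functions are complex-valued, $f'$ is the weak derivative, and $f(a^*)$ is the value at $a^*$ of the representative of $f$ that is continuous on $(0,a^*]$. Let $\mathcal F=\{f\in L^2(0,a^*): f'\in L^2((0,a^*);a\,da)\}$. Then for every $z\in[0,1]$ there is a unique $f_z\in\mathcal F$ with $(aG_zf_z')'\in L^2(0,a^*)$ that solves the system $$\begin{cases}-(aG_zf_z')'+\frac{b^2a}{G_z}f_z=0\quad\text{a.e. on }(0,a^*),\\ \lim_{a\to0^+}aG_z(a)f_z'(a)=0,\\ a^*G_z(a^*)f_z'(a^*)=\kappa(z)f_z(a^*),\\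 f_z(a^*)=1,\end{cases}$$ where the limit at $0$ and the value at $a^*$ of $aG_zf_z'$ are those of its continuous representative. The function $f_z$ is (after modification on a null set) locally absolutely continuous on $(0,a^*]$, and $f_z(a)\neq0$ for all $a\in(0,a^*)$. Moreover, with $X_z(a)=f_z(a)$ and $Y_z(a)=aG_z(a)f_z'(a)$, the function $\left(|Y_z(a)|^2-b^2a^2|X_z(a)|^2\right)\frac{\delta G(a)}{a\,G_z(a)^2}$ is integrable on $(0,a^*)$, the function $\kappa:[0,1]\to\mathbb R$ is differentiable at $z$ (one-sidedly if $z\in\{0,1\}$), and $$\kappa'(z)=\int_0^{a^*}\left(|Y_z(a)|^2-b^2a^2|X_z(a)|^2\right)\frac{\delta G(a)}{a\,G_z(a)^2}\,da .$$ -/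

import Mathlib

open MeasureTheory Set Filter Topology
open scoped ContDiff

namespace SteklovAux

noncomputable section

/-- `g` is the weak derivative of `f` on the interval `(0, A)`: both functions are locally
integrable there, and integration by parts holds against every smooth test function whose
support is a compact subset of `(0, A)`. -/
def HasWeakDeriv (A : ℝ) (f g : ℝ → ℂ) : Prop :=
  LocallyIntegrableOn f (Ioo 0 A) ∧ LocallyIntegrableOn g (Ioo 0 A) ∧
    ∀ φ : ℝ → ℝ, ContDiff ℝ ∞ φ → HasCompactSupport φ → tsupport φ ⊆ Ioo 0 A →
      ∫ a in Ioo 0 A, deriv φ a • f a = - ∫ a in Ioo 0 A, φ a • g a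

/-- `f ∈ L²(0, A)`. -/
def MemL2 (A : ℝ) (f : ℝ → ℂ) : Prop :=
  MemLp f 2 (volume.restrict (Ioo 0 A))

/-- `f ∈ L²((0, A); w(a) da)`. -/
def MemWeightedL2 (A : ℝ) (w : ℝ → ℝ) (f : ℝ → ℂ) : Prop :=
  MemLp f 2 ((volume.restrict (Ioo 0 A)).withDensity (fun a => ENNReal.ofReal (w a)))

/-- `f` belongs to `{f ∈ L²(0, A) : f' ∈ L²((0, A); w(a) da)}`, with weak derivative `f'`. -/
def MemSpace (A : ℝ) (w : ℝ → ℝ) (f f' : ℝ → ℂ) : Prop :=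
  MemL2 A f ∧ HasWeakDeriv A f f' ∧ MemWeightedL2 A w f'

/-- `F` is a representative of (the almost everywhere class of) `f` on `(0, A)` that is
continuous on `(0, A]`. It is unique on `(0, A]` when it exists, and `F A` is the boundary value
of `f` at `A`. Elements of the spaces above with `w` bounded below by a positive multiple of `a`
always have one. -/
def IsContRep (A : ℝ) (f F : ℝ → ℂ) : Prop :=
  ContinuousOn F (Ioc 0 A) ∧ F =ᵐ[volume.restrict (Ioo 0 A)] f

/-- The energy `∫ (a G |f'|² + (b² a / G) |f|²) da` over `(0, A)`. -/
def energy (b A : ℝ) (G : ℝ → ℝ) (f f' : ℝ → ℂ) : ℝ :=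
  ∫ a in Ioo 0 A, (a * G a * ‖f' a‖ ^ 2 + b ^ 2 * a / G a * ‖f a‖ ^ 2)

/-- `κ₁(b, G)`: the infimum of `energy / |f(A)|²` over all `f ∈ L²(0, A)` with
`f' ∈ L²((0, A); a G(a) da)` and `f(A) ≠ 0`. -/
def kappaOne (b A : ℝ) (G : ℝ → ℝ) : ℝ :=
  sInf {q : ℝ | ∃ f f' F : ℝ → ℂ, MemSpace A (fun a => a * G a) f f' ∧ IsContRep A f F ∧
    F A ≠ 0 ∧ q = energy b A G f f' / ‖F A‖ ^ 2}

/-- The interpolated weight `G_z = (1 - z) G₀ + z G₁`. -/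
def weightPath (G₀ G₁ : ℝ → ℝ) (z : ℝ) : ℝ → ℝ :=
  fun a => (1 - z) * G₀ a + z * G₁ a

/-- The flux `a G(a) f'(a)`. -/
def flux (G : ℝ → ℝ) (f' : ℝ → ℂ) : ℝ → ℂ :=
  fun a => ((a * G a : ℝ) : ℂ) * f' a

/-- `f`, with weak derivative `f'`, lies in `{f ∈ L²(0, A) : f' ∈ L²((0, A); a da)}`, satisfies
`(a G f')' ∈ L²(0, A)` and solves the system
`-(a G f')' + (b² a / G) f = 0` on `(0, A)`, `lim_{a → 0} a G(a) f'(a) = 0`,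
`A G(A) f'(A) = κ f(A)`, `f(A) = 1`.
The values of `f` and of `a G f'` at `A` and the limit at `0` are those of the
continuous representatives `X` and `Y`; `h` is the weak derivative of `a G f'`. -/
def IsSolution (b A : ℝ) (G : ℝ → ℝ) (κ : ℝ) (f f' : ℝ → ℂ) : Prop :=
  MemSpace A (fun a => a) f f' ∧
    ∃ X Y h : ℝ → ℂ,
      IsContRep A f X ∧ IsContRep A (flux G f') Y ∧
      HasWeakDeriv A (flux G f') h ∧ MemL2 A h ∧
      (∀ᵐ a ∂(volume.restrict (Ioo 0 A)), - h a + ((b ^ 2 * a / G a : ℝ) : ℂ) * f a = 0) ∧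
      Tendsto Y (𝓝[>] 0) (𝓝 0) ∧
      Y A = (κ : ℂ) * X A ∧
      X A = 1

/-- The integrand `(|Y|² - b² a² |X|²) δG / (a G²)`. -/
def derivIntegrand (b : ℝ) (G δG : ℝ → ℝ) (X Y : ℝ → ℂ) : ℝ → ℝ :=
  fun a => (‖Y a‖ ^ 2 - b ^ 2 * a ^ 2 * ‖X a‖ ^ 2) * (δG a / (a * G a ^ 2))

end

end SteklovAux

/-! Every object in the statement depends only on the almost everywhere class of the weight, so `G₀`
and `G₁` are replaced by measurable weights with values in `[4π, M]` everywhere. For such a weight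
`H` the solution regular at `0` satisfies `X = 1 + ∫ Y/(sH)`, `Y = ∫ b² t X/H`. This Volterra
equation has a fixed point by contraction in an exponentially weighted sup norm. Positivity of the
operator gives `X ≥ 1` and `Y ≥ 0`, and the bounds show that `Y(a) = O(a)` and that `X`, `Y` depend
on `H` in a Lipschitz way. The infimum is then explicit: `κ = Y(A)/X(A)`. The lower bound is
Picone's inequality: the energy density minus `((Y/X)|f|²)'` is a weighted square. The boundary term
at `x → 0` is at most `K x |f(x)|²`; it cannot stay above a positive constant, because `|f|²` is
integrable and `1/x` is not. Equality holds for `X/X(A)`, whose energy density is the derivative of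
a product (`energy_solC`, `kappaOne_eq`). Uniqueness follows from the Wronskian: any solution has
the same Cauchy data at `A` as `X/X(A)`, so its Wronskian with `X` vanishes and its quotient by `X`
is constant. For the derivative, the Wronskian of the normalised solutions of two weights gives an
exact formula for the difference of their `κ`, with `G - H` as a factor (`kappaOne_sub`). Along the
affine path this turns the difference quotient into an integral, and dominated convergence passes to
the limit. -/

open scoped BoundedContinuousFunction

/-! ### Calculus of absolutely continuous functions with a prescribed a.e. derivative. -/

namespace SteklovAux

/-- A function whose increments are dominated by those of an absolutely continuous function is
absolutely continuous. -/
theorem absolutelyContinuous_of_dist_le {X X' : Type*} [PseudoMetricSpace X] [PseudoMetricSpace X']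
    {F : ℝ → X} {H : ℝ → X'} {c d : ℝ} (K : ℝ) (hF : AbsolutelyContinuousOnInterval F c d)
    (h : ∀ x ∈ uIcc c d, ∀ y ∈ uIcc c d, dist (H x) (H y) ≤ K * dist (F x) (F y)) :
    AbsolutelyContinuousOnInterval H c d := by
  apply squeeze_zero' ?_ ?_ (by simpa using Tendsto.const_mul K hF)
  · exact Eventually.of_forall fun t ↦ Finset.sum_nonneg (fun i hi ↦ by positivity)
  · refine Eventually.filter_mono inf_le_right ?_
    rw [eventually_principal]
    intro E hE
    rw [Finset.mul_sum]
    exact Finset.sum_le_sum fun i hi => h _ (hE.1 i hi).1 _ (hE.1 i hi).2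

/-- `F` is absolutely continuous on `[c, d]` with almost everywhere derivative `f`. -/
structure HasACDeriv {E : Type*} [NormedAddCommGroup E] [NormedSpace ℝ E] (F f : ℝ → E)
    (c d : ℝ) : Prop where
  ac : AbsolutelyContinuousOnInterval F c d
  hasDerivAt : ∀ᵐ x, x ∈ uIcc c d → HasDerivAt F (f x) x

theorem ae_mem_uIcc_of_ae_mem_Ioo {c d : ℝ} (hcd : c ≤ d) {p : ℝ → Prop}
    (h : ∀ᵐ x, x ∈ Ioo c d → p x) : ∀ᵐ x, x ∈ uIcc c d → p x := by
  filter_upwards [h, measure_eq_zero_iff_ae_notMem.1 (measure_singleton (μ := volume) c),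
    measure_eq_zero_iff_ae_notMem.1 (measure_singleton (μ := volume) d)] with x hx hc hd hm
  rw [uIcc_of_le hcd] at hm
  exact hx ⟨lt_of_le_of_ne hm.1 (fun h => hc h.symm), lt_of_le_of_ne hm.2 hd⟩

namespace HasACDeriv

section general
variable {E : Type*} [NormedAddCommGroup E] [NormedSpace ℝ E] {F f G g : ℝ → E} {c d c' d' : ℝ}

theorem mono (h : HasACDeriv F f c d) (hs : uIcc c' d' ⊆ uIcc c d) : HasACDeriv F f c' d' :=
  ⟨h.ac.mono hs, h.hasDerivAt.mono fun _ hx hm => hx (hs hm)⟩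

theorem congr_deriv (h : HasACDeriv F f c d) (hg : ∀ᵐ x, x ∈ uIcc c d → f x = g x) :
    HasACDeriv F g c d :=
  ⟨h.ac, by filter_upwards [h.hasDerivAt, hg] with x h1 h2 hm; exact h2 hm ▸ h1 hm⟩

theorem congr (hcd : c ≤ d) (h : HasACDeriv F f c d) (hG : ∀ x ∈ Icc c d, G x = F x) :
    HasACDeriv G f c d := by
  refine ⟨absolutelyContinuous_of_dist_le 1 h.ac fun x hx y hy => ?_,
    ae_mem_uIcc_of_ae_mem_Ioo hcd ?_⟩
  · rw [uIcc_of_le hcd] at hx hy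
    rw [hG x hx, hG y hy, one_mul]
  · filter_upwards [h.hasDerivAt] with x hx hm
    refine (hx (uIcc_of_le hcd ▸ Ioo_subset_Icc_self hm)).congr_of_eventuallyEq ?_
    filter_upwards [Ioo_mem_nhds hm.1 hm.2] with y hy using hG y (Ioo_subset_Icc_self hy)

theorem add (hF : HasACDeriv F f c d) (hG : HasACDeriv G g c d) :
    HasACDeriv (fun x => F x + G x) (fun x => f x + g x) c d :=
  ⟨hF.ac.add hG.ac, by
    filter_upwards [hF.hasDerivAt, hG.hasDerivAt] with x h1 h2 hm using (h1 hm).add (h2 hm)⟩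

theorem sub (hF : HasACDeriv F f c d) (hG : HasACDeriv G g c d) :
    HasACDeriv (fun x => F x - G x) (fun x => f x - g x) c d :=
  ⟨hF.ac.sub hG.ac, by
    filter_upwards [hF.hasDerivAt, hG.hasDerivAt] with x h1 h2 hm using (h1 hm).sub (h2 hm)⟩

theorem const (C : E) (c d : ℝ) : HasACDeriv (fun _ => C) (fun _ => 0) c d :=
  ⟨(contDiff_const.contDiffOn).absolutelyContinuousOnInterval,
    Eventually.of_forall fun x _ => hasDerivAt_const x C⟩

theorem clm_comp {E' : Type*} [NormedAddCommGroup E'] [NormedSpace ℝ E'] (L : E →L[ℝ] E')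
    (hF : HasACDeriv F f c d) : HasACDeriv (fun x => L (F x)) (fun x => L (f x)) c d :=
  ⟨absolutelyContinuous_of_dist_le ‖L‖ hF.ac fun x _ y _ => L.lipschitz.dist_le_mul _ _, by
    filter_upwards [hF.hasDerivAt] with x h1 hm
    exact L.hasFDerivAt.comp_hasDerivAt x (h1 hm)⟩

/-- Used twice for uniqueness: for the Wronskian of two solutions and for their quotient. -/
theorem eq_of_deriv_eq_zero (h : HasACDeriv F f c d) (h0 : ∀ᵐ x, x ∈ uIcc c d → f x = 0) :
    F c = F d := by
  obtain ⟨C, hC⟩ := (h.congr_deriv (g := fun _ => 0) h0).ac.const_of_ae_hasDerivAt_zero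
    (h.congr_deriv (g := fun _ => 0) h0).hasDerivAt
  rw [hC c left_mem_uIcc, hC d right_mem_uIcc]

end general

section alg
variable {𝔸 : Type*} [NormedRing 𝔸] [NormMulClass 𝔸] [NormedAlgebra ℝ 𝔸]
  {F f G g : ℝ → 𝔸} {c d : ℝ}

theorem mul (hF : HasACDeriv F f c d) (hG : HasACDeriv G g c d) :
    HasACDeriv (fun x => F x * G x) (fun x => f x * G x + F x * g x) c d :=
  ⟨hF.ac.smul hG.ac, by
    filter_upwards [hF.hasDerivAt, hG.hasDerivAt] with x h1 h2 hm using (h1 hm).mul (h2 hm)⟩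

theorem const_mul (C : 𝔸) (hF : HasACDeriv F f c d) :
    HasACDeriv (fun x => C * F x) (fun x => C * f x) c d := by
  simpa using (const C c d).mul hF

end alg

theorem inv_of_one_le {F f : ℝ → ℝ} {c d : ℝ} (hF : HasACDeriv F f c d)
    (h1 : ∀ x ∈ uIcc c d, 1 ≤ F x) :
    HasACDeriv (fun x => (F x)⁻¹) (fun x => - f x / F x ^ 2) c d := by
  -- Inversion is 1-Lipschitz on `[1, ∞)`.
  refine ⟨absolutelyContinuous_of_dist_le 1 hF.ac fun x hx y hy => ?_, ?_⟩
  · have hx1 := h1 x hx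
    have hy1 := h1 y hy
    rw [one_mul, Real.dist_eq, Real.dist_eq, inv_sub_inv (by positivity) (by positivity), abs_div,
      abs_sub_comm]
    refine div_le_self (abs_nonneg _) ?_
    rw [abs_of_pos (by positivity)]
    nlinarith
  · filter_upwards [hF.hasDerivAt] with x h hm
    exact (h hm).inv (by linarith [h1 x hm])

theorem ofReal {F f : ℝ → ℝ} {c d : ℝ} (hF : HasACDeriv F f c d) :
    HasACDeriv (fun x => (F x : ℂ)) (fun x => (f x : ℂ)) c d := hF.clm_comp Complex.ofRealCLM

theorem intervalIntegrable {f F : ℝ → ℝ} {c d : ℝ} (hF : HasACDeriv F f c d) :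
    IntervalIntegrable f volume c d := by
  refine hF.ac.intervalIntegrable_deriv.congr_ae ?_
  rw [EventuallyEq, ae_restrict_iff' measurableSet_uIoc]
  filter_upwards [hF.hasDerivAt] with x h hm using (h (uIoc_subset_uIcc hm)).deriv

theorem integral_eq {f F : ℝ → ℝ} {c d : ℝ} (hF : HasACDeriv F f c d) :
    ∫ x in c..d, f x = F d - F c := by
  rw [← hF.ac.integral_deriv_eq_sub]
  apply intervalIntegral.integral_congr_ae
  filter_upwards [hF.hasDerivAt] with x h hm using (h (uIoc_subset_uIcc hm)).deriv.symm

theorem re {f F : ℝ → ℂ} {c d : ℝ} (hF : HasACDeriv F f c d) :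
    HasACDeriv (fun x => (F x).re) (fun x => (f x).re) c d := hF.clm_comp Complex.reCLM

theorem im {f F : ℝ → ℂ} {c d : ℝ} (hF : HasACDeriv F f c d) :
    HasACDeriv (fun x => (F x).im) (fun x => (f x).im) c d := hF.clm_comp Complex.imCLM

theorem intervalIntegrable_complex {f F : ℝ → ℂ} {c d : ℝ} (hF : HasACDeriv F f c d) :
    IntervalIntegrable f volume c d := by
  have h1 := hF.re.intervalIntegrable
  have h2 := hF.im.intervalIntegrable
  have h := IntervalIntegrable.add (μ := volume) (a := c) (b := d)
    (f := fun x => ((f x).re : ℂ)) ⟨h1.1.ofReal, h1.2.ofReal⟩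
    (IntervalIntegrable.mul_const (f := fun x => ((f x).im : ℂ)) ⟨h2.1.ofReal, h2.2.ofReal⟩
      Complex.I)
  refine h.congr fun x _ => ?_
  simp [Complex.re_add_im]

theorem integral_complex_eq {f F : ℝ → ℂ} {c d : ℝ} (hF : HasACDeriv F f c d) :
    ∫ x in c..d, f x = F d - F c := by
  have hi := hF.intervalIntegrable_complex
  have h1 := Complex.reCLM.intervalIntegral_comp_comm hi
  have h2 := Complex.imCLM.intervalIntegral_comp_comm hi
  simp only [Complex.reCLM_apply, Complex.imCLM_apply] at h1 h2
  rw [hF.re.integral_eq] at h1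
  rw [hF.im.integral_eq] at h2
  apply Complex.ext <;> simp [← h1, ← h2]

theorem intervalIntegral {f : ℝ → ℝ} {c d m : ℝ} (hf : IntervalIntegrable f volume c d)
    (hm : m ∈ uIcc c d) : HasACDeriv (fun x => ∫ t in m..x, f t) f c d :=
  ⟨hf.absolutelyContinuousOnInterval_intervalIntegral hm, by
    filter_upwards [hf.ae_hasDerivAt_integral] with x h hx using h hx m hm⟩

theorem intervalIntegral_complex {f : ℝ → ℂ} {c d m : ℝ} (hf : IntervalIntegrable f volume c d)
    (hm : m ∈ uIcc c d) : HasACDeriv (fun x => ∫ t in m..x, f t) f c d := by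
  refine ⟨?_, by filter_upwards [hf.ae_hasDerivAt_integral] with x h hx using h hx m hm⟩
  have hre : IntervalIntegrable (fun x => (f x).re) volume c d := ⟨hf.1.re, hf.2.re⟩
  have him : IntervalIntegrable (fun x => (f x).im) volume c d := ⟨hf.1.im, hf.2.im⟩
  have h := ((intervalIntegral hre hm).ofReal.add
    ((intervalIntegral him hm).ofReal.const_mul Complex.I)).ac
  -- The primitive agrees on the interval with the combination of the real and imaginary primitives,
  -- so it has the same increments.
  refine absolutelyContinuous_of_dist_le 1 h fun x hx y hy => ?_
  have key : ∀ x ∈ uIcc c d, ∫ t in m..x, f t = ((∫ t in m..x, (f t).re : ℝ) : ℂ)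
      + Complex.I * ((∫ t in m..x, (f t).im : ℝ) : ℂ) := by
    intro x hx
    have hi : IntervalIntegrable f volume m x := hf.mono_set (uIcc_subset_uIcc hm hx)
    have h1 := Complex.reCLM.intervalIntegral_comp_comm hi
    have h2 := Complex.imCLM.intervalIntegral_comp_comm hi
    simp only [Complex.reCLM_apply, Complex.imCLM_apply] at h1 h2
    apply Complex.ext <;> simp [h1, h2]
  rw [key x hx, key y hy, one_mul]

end HasACDeriv

end SteklovAux

/-! ### Weak derivatives on an interval and their absolutely continuous representatives. -/

namespace SteklovAux

theorem exists_Icc_of_isCompact {A : ℝ} (hA : 0 < A) {K : Set ℝ} (hK : IsCompact K)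
    (hKA : K ⊆ Ioo 0 A) : ∃ c d, 0 < c ∧ c ≤ d ∧ d < A ∧ K ⊆ Icc c d := by
  rcases K.eq_empty_or_nonempty with rfl | hne
  · exact ⟨A / 2, A / 2, by linarith, le_rfl, by linarith, by simp⟩
  · obtain ⟨c, hc⟩ := hK.exists_isLeast hne
    obtain ⟨d, hd⟩ := hK.exists_isGreatest hne
    exact ⟨c, d, (hKA hc.1).1, hc.2 hd.1, (hKA hd.1).2, fun x hx => ⟨hc.2 hx, hd.2 hx⟩⟩

theorem integrableOn_smul_of_tsupport_subset {A : ℝ} {φ : ℝ → ℝ} {u : ℝ → ℂ} (hφ : Continuous φ)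
    (hc : HasCompactSupport φ) (hs : tsupport φ ⊆ Ioo 0 A)
    (hu : LocallyIntegrableOn u (Ioo 0 A)) : IntegrableOn (fun x => φ x • u x) (Ioo 0 A) := by
  have h1 : IntegrableOn u (tsupport φ) := hu.integrableOn_compact_subset hs hc
  obtain ⟨C, hC⟩ := hc.exists_bound_of_continuous hφ
  have h2 : IntegrableOn (fun x => φ x • u x) (tsupport φ) :=
    Integrable.bdd_smul h1 C hφ.aestronglyMeasurable (Eventually.of_forall hC)
  refine h2.of_forall_sdiff_eq_zero measurableSet_Ioo fun x hx => ?_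
  rw [image_eq_zero_of_notMem_tsupport hx.2, zero_smul]

/-- The primitive from `0` vanishes to the left of the support because the integrand does, and to
the right of it because the total integral is zero. -/
theorem exists_primitive_of_integral_eq_zero {A : ℝ} (hA : 0 < A) {η : ℝ → ℝ}
    (hη : ContDiff ℝ ∞ η) (hc : HasCompactSupport η) (hs : tsupport η ⊆ Ioo 0 A)
    (h0 : ∫ x, η x = 0) :
    ∃ ζ : ℝ → ℝ, ContDiff ℝ ∞ ζ ∧ HasCompactSupport ζ ∧ tsupport ζ ⊆ Ioo 0 A ∧ deriv ζ = η := by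
  obtain ⟨c, d, hc0, hcd, hdA, hK⟩ := exists_Icc_of_isCompact hA hc hs
  have hder : ∀ x, HasDerivAt (fun x => ∫ t in (0 : ℝ)..x, η t) (η x) x := fun x =>
    intervalIntegral.integral_hasDerivAt_right (hη.continuous.intervalIntegrable _ _)
      (hη.continuous.stronglyMeasurableAtFilter _ _) hη.continuous.continuousAt
  have hderiv : deriv (fun x => ∫ t in (0 : ℝ)..x, η t) = η := funext fun x => (hder x).deriv
  have hz : ∀ x, x ∉ Icc c d → η x = 0 := fun x hx =>
    image_eq_zero_of_notMem_tsupport fun h => hx (hK h)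
  have hsupp : tsupport (fun x => ∫ t in (0 : ℝ)..x, η t) ⊆ Icc c d := by
    refine closure_minimal (fun x hx => ?_) isClosed_Icc
    by_contra hxcd
    apply hx
    rcases not_and_or.1 hxcd with h | h
    · refine intervalIntegral.integral_zero_ae (Eventually.of_forall fun t ht => hz t fun htc => ?_)
      have := (uIoc_subset_uIcc ht).2
      rcases le_max_iff.1 this with h' | h' <;> [linarith [htc.1]; linarith [htc.1]]
    · show ∫ t in (0 : ℝ)..x, η t = 0
      rw [intervalIntegral.integral_eq_integral_of_support_subset, h0]
      intro t ht
      by_contra htc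
      refine ht (hz t fun h' => htc ⟨by linarith [h'.1], by linarith [h'.2]⟩)
  exact ⟨_, contDiff_infty_iff_deriv.2 ⟨fun x => (hder x).differentiableAt, by rwa [hderiv]⟩,
    isCompact_Icc.of_isClosed_subset (isClosed_tsupport _) hsupp,
    hsupp.trans (Icc_subset_Ioo hc0 hdA), hderiv⟩

/-- A locally integrable function with vanishing weak derivative is constant. -/
theorem ae_eq_const_of_weak_deriv_zero {A : ℝ} (hA : 0 < A) {u : ℝ → ℂ}
    (hu : LocallyIntegrableOn u (Ioo 0 A))
    (h : ∀ φ : ℝ → ℝ, ContDiff ℝ ∞ φ → HasCompactSupport φ → tsupport φ ⊆ Ioo 0 A →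
      ∫ a in Ioo 0 A, deriv φ a • u a = 0) :
    ∃ C : ℂ, ∀ᵐ x, x ∈ Ioo 0 A → u x = C := by
  -- The du Bois-Reymond argument: `ψ` is a test function of mass one, and the constant will be `∫ ψ
  -- u`.
  let B : ContDiffBump (A / 2) := ⟨A / 8, A / 4, by linarith, by linarith⟩
  set ψ : ℝ → ℝ := B.normed volume with hψ
  have ψs : ContDiff ℝ ∞ ψ := B.contDiff_normed
  have ψc : HasCompactSupport ψ := B.hasCompactSupport_normed
  have ψt : tsupport ψ ⊆ Ioo 0 A := by
    rw [hψ, B.tsupport_normed_eq, Real.closedBall_eq_Icc]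
    intro x hx
    have h1 : A / 2 - A / 4 ≤ x := hx.1
    have h2 : x ≤ A / 2 + A / 4 := hx.2
    constructor <;> linarith
  have ψi : ∫ x, ψ x = 1 := B.integral_normed
  refine ⟨∫ x in Ioo 0 A, ψ x • u x, ?_⟩
  set C := ∫ x in Ioo 0 A, ψ x • u x
  suffices ∀ᵐ x, x ∈ Ioo 0 A → u x - C = 0 by
    filter_upwards [this] with x hx hm using sub_eq_zero.1 (hx hm)
  refine isOpen_Ioo.ae_eq_zero_of_integral_contDiff_smul_eq_zero
    (hu.sub (locallyIntegrableOn_const _)) fun φ φs φc φt => ?_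
  have hφi : Integrable φ := φs.continuous.integrable_of_hasCompactSupport φc
  have hψi : Integrable ψ := ψs.continuous.integrable_of_hasCompactSupport ψc
  have hts : tsupport (fun x => φ x - (∫ y, φ y) * ψ x) ⊆ tsupport φ ∪ tsupport ψ := by
    refine closure_minimal (fun x hx => ?_) ((isClosed_tsupport _).union (isClosed_tsupport _))
    by_contra hn
    rw [mem_union, not_or] at hn
    apply hx
    simp [image_eq_zero_of_notMem_tsupport hn.1, image_eq_zero_of_notMem_tsupport hn.2]
  -- Subtracting `(∫ φ) ψ` leaves mean zero, hence the derivative of a test function, to which the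
  -- hypothesis applies.
  obtain ⟨ζ, ζs, ζc, ζt, hζ⟩ := exists_primitive_of_integral_eq_zero hA
    (η := fun x => φ x - (∫ y, φ y) * ψ x) (φs.sub (contDiff_const.mul ψs))
    ((IsCompact.union φc ψc).of_isClosed_subset (isClosed_tsupport _) hts)
    (hts.trans (union_subset φt ψt))
    (by rw [integral_sub hφi (hψi.const_mul _), integral_const_mul, ψi, mul_one, sub_self])
  have key := h ζ ζs ζc ζt
  rw [hζ] at key
  have I1 := integrableOn_smul_of_tsupport_subset φs.continuous φc φt hu
  have I2 := integrableOn_smul_of_tsupport_subset ψs.continuous ψc ψt hu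
  have e1 : ∫ x in Ioo 0 A, φ x • u x = (∫ y, φ y) • C := by
    have e := integral_sub I1 (I2.smul (∫ y, φ y))
    simp only [Pi.smul_apply] at e
    rw [← sub_eq_zero, ← key, ← integral_smul, ← e]
    refine integral_congr_ae (Eventually.of_forall fun x => ?_)
    simp only [sub_smul, mul_smul]
  have hφz : ∀ x, x ∉ Ioo 0 A → φ x = 0 := fun x hx =>
    image_eq_zero_of_notMem_tsupport fun h => hx (φt h)
  rw [← setIntegral_eq_integral_of_forall_compl_eq_zero (s := Ioo 0 A)
    (fun x hx => by rw [hφz x hx, zero_smul])]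
  simp only [smul_sub]
  rw [integral_sub I1 (hφi.smul_const C).integrableOn, e1, integral_smul_const,
    setIntegral_eq_integral_of_forall_compl_eq_zero hφz, sub_self]

/-- Integration by parts of an absolutely continuous function against a test function. -/
theorem integral_deriv_smul_eq_neg {A : ℝ} (hA : 0 < A) {F f : ℝ → ℂ}
    (h : ∀ c d, 0 < c → c ≤ d → d < A → HasACDeriv F f c d) {φ : ℝ → ℝ} (hφ : ContDiff ℝ ∞ φ)
    (hc : HasCompactSupport φ) (hs : tsupport φ ⊆ Ioo 0 A) :
    ∫ a in Ioo 0 A, deriv φ a • F a = - ∫ a in Ioo 0 A, φ a • f a := by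
  obtain ⟨c, d, hc0, hcd, hdA, hK⟩ := exists_Icc_of_isCompact hA hc hs
  -- The interval is enlarged so that `φ` vanishes at both ends and no boundary terms remain.
  have hcd' : c / 2 ≤ (d + A) / 2 := by linarith
  have hF := h (c / 2) ((d + A) / 2) (by linarith) hcd' (by linarith)
  have hz : ∀ x, x ∉ Icc c d → φ x = 0 := fun x hx =>
    image_eq_zero_of_notMem_tsupport fun h => hx (hK h)
  have hz' : ∀ x, x ∉ Icc c d → deriv φ x = 0 := fun x hx => by
    by_contra hne
    exact hx (hK (support_deriv_subset hne))
  have hI : ∀ g : ℝ → ℂ, (∀ x, x ∉ Icc c d → g x = 0) →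
      ∫ a in Ioo 0 A, g a = ∫ a in (c / 2)..((d + A) / 2), g a := by
    intro g hg
    rw [intervalIntegral.integral_eq_integral_of_support_subset,
      setIntegral_eq_integral_of_forall_compl_eq_zero]
    · exact fun x hx => hg x fun h' => hx ⟨by linarith [h'.1], by linarith [h'.2]⟩
    · intro x hx
      by_contra hn
      exact hx (hg x fun h' => hn ⟨by linarith [h'.1], by linarith [h'.2]⟩)
  have hφAC : HasACDeriv φ (deriv φ) (c / 2) ((d + A) / 2) :=
    ⟨(hφ.of_le (by exact_mod_cast le_top)).contDiffOn.absolutelyContinuousOnInterval,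
      Eventually.of_forall fun x _ => (hφ.differentiable (by simp) x).hasDerivAt⟩
  have hprod := (hφAC.ofReal.mul hF).integral_complex_eq
  rw [hz ((d + A) / 2) (fun h' => by linarith [h'.2]), hz (c / 2) (fun h' => by linarith [h'.1]),
    intervalIntegral.integral_add] at hprod
  · rw [hI _ (fun x hx => by rw [hz' x hx, zero_smul]), hI _ (fun x hx => by rw [hz x hx, zero_smul])]
    simp only [Complex.real_smul]
    rw [eq_neg_iff_add_eq_zero, hprod]
    simp
  · refine (ContinuousOn.mul ?_ hF.ac.continuousOn).intervalIntegrable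
    exact (Complex.continuous_ofReal.comp (hφ.continuous_deriv (by simp))).continuousOn
  · refine hF.intervalIntegrable_complex.continuousOn_mul ?_
    exact (Complex.continuous_ofReal.comp hφ.continuous).continuousOn

theorem locallyIntegrableOn_Ioo {A : ℝ} (hA : 0 < A) {f : ℝ → ℂ}
    (h : ∀ c d, 0 < c → c ≤ d → d < A → IntegrableOn f (Icc c d)) :
    LocallyIntegrableOn f (Ioo 0 A) := by
  refine (locallyIntegrableOn_iff isOpen_Ioo.isLocallyClosed).2 fun K hK hc => ?_
  obtain ⟨c, d, hc0, hcd, hdA, hKcd⟩ := exists_Icc_of_isCompact hA hc hK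
  exact (h c d hc0 hcd hdA).mono_set hKcd

theorem hasWeakDeriv_of_hasACDeriv {A : ℝ} (hA : 0 < A) {F f : ℝ → ℂ}
    (h : ∀ c d, 0 < c → c ≤ d → d < A → HasACDeriv F f c d) : HasWeakDeriv A F f := by
  refine ⟨locallyIntegrableOn_Ioo hA fun c d h0 hcd hd => ?_,
    locallyIntegrableOn_Ioo hA fun c d h0 hcd hd => ?_,
    fun φ hφ hc hs => integral_deriv_smul_eq_neg hA h hφ hc hs⟩
  · have := (h c d h0 hcd hd).ac.continuousOn
    rw [uIcc_of_le hcd] at this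
    exact this.integrableOn_Icc
  · exact (intervalIntegrable_iff_integrableOn_Icc_of_le hcd).1
      (h c d h0 hcd hd).intervalIntegrable_complex

/-- The continuous representative of a weakly differentiable function whose derivative is
integrable away from `0` is absolutely continuous away from `0`. -/
theorem HasWeakDeriv.hasACDeriv {A : ℝ} (hA : 0 < A) {f g X : ℝ → ℂ} (h : HasWeakDeriv A f g)
    (hX : IsContRep A f X) (hg : ∀ c, 0 < c → c ≤ A → IntegrableOn g (Ioo c A)) :
    ∀ c, 0 < c → c ≤ A → HasACDeriv X g c A := by
  -- The primitive based at `A` also has weak derivative `g`, so `f - P` is a.e. constant; by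
  -- continuity `X = C + P` on all of `(0, A]`, endpoint included.
  set P : ℝ → ℂ := fun x => ∫ t in A..x, g t with hP
  have hPA : ∀ c, 0 < c → c ≤ A → HasACDeriv P g c A := fun c h0 hc =>
    HasACDeriv.intervalIntegral_complex
      ((intervalIntegrable_iff_integrableOn_Ioo_of_le hc).2 (hg c h0 hc)) right_mem_uIcc
  have hPA' : ∀ c d, 0 < c → c ≤ d → d < A → HasACDeriv P g c d := fun c d h0 hcd hd =>
    (hPA c h0 (hcd.trans hd.le)).mono (by
      rw [uIcc_of_le hcd, uIcc_of_le (hcd.trans hd.le)]; exact Icc_subset_Icc_right hd.le)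
  have hPw := hasWeakDeriv_of_hasACDeriv hA hPA'
  obtain ⟨C, hC⟩ := ae_eq_const_of_weak_deriv_zero hA (u := fun x => f x - P x)
    (h.1.sub hPw.1) (fun φ hφ hc hs => by
      have hdc : HasCompactSupport (deriv φ) := hc.deriv
      have hds : tsupport (deriv φ) ⊆ Ioo 0 A := (tsupport_deriv_subset (𝕜 := ℝ)).trans hs
      have hdk : Continuous (deriv φ) := hφ.continuous_deriv (by simp)
      simp only [smul_sub]
      rw [integral_sub (integrableOn_smul_of_tsupport_subset hdk hdc hds h.1)
        (integrableOn_smul_of_tsupport_subset hdk hdc hds hPw.1), h.2.2 φ hφ hc hs,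
        hPw.2.2 φ hφ hc hs, sub_self])
  have hPcont : ContinuousOn P (Ioc 0 A) := by
    intro x hx
    have := (hPA (x / 2) (by linarith [hx.1]) (by linarith [hx.1, hx.2])).ac.continuousOn
    rw [uIcc_of_le (by linarith [hx.1, hx.2])] at this
    refine (this x ⟨by linarith [hx.1], hx.2⟩).mono_of_mem_nhdsWithin ?_
    filter_upwards [self_mem_nhdsWithin, mem_nhdsWithin_of_mem_nhds
      (Ioi_mem_nhds (show x / 2 < x by linarith [hx.1]))] with y hy hy'
    exact ⟨le_of_lt hy', hy.2⟩
  have heq : EqOn X (fun x => C + P x) (Ioc 0 A) := by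
    refine Measure.eqOn_Ioc_of_ae_eq (μ := volume) ?_ hX.1 (continuousOn_const.add hPcont)
    rw [← Measure.restrict_congr_set (Ioo_ae_eq_Ioc (μ := volume) (a := 0) (b := A))]
    filter_upwards [hX.2, (ae_restrict_iff' measurableSet_Ioo).2 hC] with x h1 h2
    rw [h1, ← h2, sub_add_cancel]
  intro c h0 hc
  refine HasACDeriv.congr hc (F := fun x => C + P x) ?_
    fun x hx => heq ⟨h0.trans_le hx.1, hx.2⟩
  simpa using (HasACDeriv.const C c A).add (hPA c h0 hc)

end SteklovAux

/-! ### Exponentially weighted bounds for the Volterra operator. -/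

namespace SteklovAux

noncomputable section

/-- The flux generated by `u`: `s ↦ ∫₀ˢ φ(t) t u(t) dt`. -/
def volterraFlux (φ u : ℝ → ℝ) (s : ℝ) : ℝ := ∫ t in (0 : ℝ)..s, φ t * (t * u t)

/-- The second-order Volterra operator `a ↦ ∫₀ᵃ ψ(s) s⁻¹ ∫₀ˢ φ(t) t u(t) dt ds`. -/
def volterra (ψ φ u : ℝ → ℝ) (a : ℝ) : ℝ := ∫ s in (0 : ℝ)..a, ψ s * (volterraFlux φ u s / s)

/-- A measurable coefficient bounded by `β` and vanishing on the negative half line. -/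
structure IsCoeff (β : ℝ) (φ : ℝ → ℝ) : Prop where
  measurable : Measurable φ
  abs_le : ∀ t, |φ t| ≤ β
  eq_zero : ∀ t ≤ 0, φ t = 0

variable {α β N l : ℝ} {φ ψ u : ℝ → ℝ}

/-- Under the weight `exp (l t)` each integration gains a factor `1 / l`. -/
theorem integral_exp_mul_le (hl : 0 < l) (s : ℝ) :
    ∫ t in (0 : ℝ)..s, Real.exp (l * t) ≤ Real.exp (l * s) / l := by
  rw [intervalIntegral.integral_comp_mul_left _ hl.ne', integral_exp, smul_eq_mul, inv_mul_eq_div]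
  gcongr
  simp

namespace IsCoeff

theorem nonneg (hφ : IsCoeff β φ) : 0 ≤ β := (abs_nonneg _).trans (hφ.abs_le 0)

theorem intervalIntegrable (hφ : IsCoeff β φ) (hu : Continuous u) (c d : ℝ) :
    IntervalIntegrable (fun t => φ t * (t * u t)) volume c d := by
  have hc : Continuous fun t => β * |t * u t| := by fun_prop
  refine (hc.intervalIntegrable c d).mono_fun
    (hφ.measurable.mul (measurable_id.mul hu.measurable)).aestronglyMeasurable
    (Eventually.of_forall fun t => ?_)
  simp only [Real.norm_eq_abs]
  rw [abs_mul, abs_of_nonneg (mul_nonneg hφ.nonneg (abs_nonneg _))]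
  exact mul_le_mul_of_nonneg_right (hφ.abs_le t) (abs_nonneg _)

theorem continuous_flux (hφ : IsCoeff β φ) (hu : Continuous u) : Continuous (volterraFlux φ u) :=
  intervalIntegral.continuous_primitive (hφ.intervalIntegrable hu) 0

/-- The cut-off makes everything trivial on the negative half line, so the estimates hold on all of
`ℝ`, where the functions of the fixed-point argument live. -/
theorem flux_eq_zero (hφ : IsCoeff β φ) {s : ℝ} (hs : s ≤ 0) : volterraFlux φ u s = 0 := by
  refine intervalIntegral.integral_zero_ae (Eventually.of_forall fun t ht => ?_)
  rw [uIoc_of_ge hs] at ht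
  rw [hφ.eq_zero t ht.2, zero_mul]

/-- The factor `|s|`, from bounding `t ≤ s` in the integrand, cancels the singular `1 / s` in the
outer integral. -/
theorem abs_flux_le (hφ : IsCoeff β φ) (hl : 0 < l)
    (hN : ∀ t, |u t| ≤ N * Real.exp (l * |t|)) (s : ℝ) :
    |volterraFlux φ u s| ≤ |s| * (β * N * Real.exp (l * |s|) / l) := by
  have hN0 : 0 ≤ N := by simpa using (abs_nonneg _).trans (hN 0)
  have hβ := hφ.nonneg
  rcases le_total s 0 with hs | hs
  · rw [hφ.flux_eq_zero hs, abs_zero]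
    positivity
  · have hb : ‖volterraFlux φ u s‖ ≤ ∫ t in (0 : ℝ)..s, s * (β * N) * Real.exp (l * t) := by
      refine intervalIntegral.norm_integral_le_of_norm_le hs (Eventually.of_forall fun t ht => ?_)
        (Continuous.intervalIntegrable (by fun_prop) _ _)
      rw [Real.norm_eq_abs, abs_mul, abs_mul, abs_of_pos ht.1]
      have h1 := hN t
      rw [abs_of_pos ht.1] at h1
      calc |φ t| * (t * |u t|) ≤ β * (s * (N * Real.exp (l * t))) := by
            gcongr
            · exact mul_nonneg ht.1.le (abs_nonneg _)
            · exact hφ.abs_le t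
            · exact ht.2
        _ = _ := by ring
    rw [intervalIntegral.integral_const_mul] at hb
    rw [abs_of_nonneg hs, ← Real.norm_eq_abs]
    refine hb.trans ((mul_le_mul_of_nonneg_left (integral_exp_mul_le hl s) (by positivity)).trans
      (le_of_eq (by ring)))

theorem abs_flux_div_le (hφ : IsCoeff β φ) (hl : 0 < l)
    (hN : ∀ t, |u t| ≤ N * Real.exp (l * |t|)) (s : ℝ) :
    |volterraFlux φ u s / s| ≤ β * N * Real.exp (l * |s|) / l := by
  have hN0 : 0 ≤ N := by simpa using (abs_nonneg _).trans (hN 0)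
  have hβ := hφ.nonneg
  rw [abs_div]
  -- This also covers `s = 0`, where the quotient is `0`.
  refine div_le_of_le_mul₀ (abs_nonneg _) (by positivity) ?_
  rw [mul_comm]
  exact hφ.abs_flux_le hl hN s

theorem abs_volterra_integrand_le (hφ : IsCoeff β φ) (hψ : ∀ t, |ψ t| ≤ α) (hl : 0 < l)
    (hN : ∀ t, |u t| ≤ N * Real.exp (l * |t|)) (s : ℝ) :
    |ψ s * (volterraFlux φ u s / s)| ≤ α * (β * N * Real.exp (l * |s|) / l) := by
  rw [abs_mul]
  exact mul_le_mul (hψ s) (hφ.abs_flux_div_le hl hN s) (abs_nonneg _)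
    ((abs_nonneg _).trans (hψ 0))

theorem volterra_intervalIntegrable (hφ : IsCoeff β φ) (hψm : Measurable ψ) (hψ : ∀ t, |ψ t| ≤ α)
    (hu : Continuous u) (hl : 0 < l) (hN : ∀ t, |u t| ≤ N * Real.exp (l * |t|)) (c d : ℝ) :
    IntervalIntegrable (fun s => ψ s * (volterraFlux φ u s / s)) volume c d := by
  have hc : Continuous fun s => α * (β * N * Real.exp (l * |s|) / l) := by fun_prop
  refine (hc.intervalIntegrable c d).mono_fun
    (hψm.mul ((hφ.continuous_flux hu).measurable.div measurable_id)).aestronglyMeasurable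
    (Eventually.of_forall fun s => ?_)
  simp only [Real.norm_eq_abs]
  exact (hφ.abs_volterra_integrand_le hψ hl hN s).trans (le_abs_self _)

theorem continuous_volterra (hφ : IsCoeff β φ) (hψm : Measurable ψ) (hψ : ∀ t, |ψ t| ≤ α)
    (hu : Continuous u) (hl : 0 < l) (hN : ∀ t, |u t| ≤ N * Real.exp (l * |t|)) :
    Continuous (volterra ψ φ u) :=
  intervalIntegral.continuous_primitive (hφ.volterra_intervalIntegrable hψm hψ hu hl hN) 0

/-- Two integrations give `1 / l ^ 2`, so a large `l` makes the operator a contraction. -/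
theorem abs_volterra_le (hφ : IsCoeff β φ) (hψ : ∀ t, |ψ t| ≤ α) (hl : 0 < l)
    (hN : ∀ t, |u t| ≤ N * Real.exp (l * |t|)) (a : ℝ) :
    |volterra ψ φ u a| ≤ α * β * N / l ^ 2 * Real.exp (l * |a|) := by
  have hN0 : 0 ≤ N := by simpa using (abs_nonneg _).trans (hN 0)
  have hβ := hφ.nonneg
  have hα : 0 ≤ α := (abs_nonneg _).trans (hψ 0)
  rcases le_total a 0 with ha | ha
  · have : volterra ψ φ u a = 0 := by
      refine intervalIntegral.integral_zero_ae (Eventually.of_forall fun t ht => ?_)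
      rw [uIoc_of_ge ha] at ht
      rw [hφ.flux_eq_zero ht.2, zero_div, mul_zero]
    rw [this, abs_zero]
    positivity
  · have hb : ‖volterra ψ φ u a‖ ≤ ∫ t in (0 : ℝ)..a, α * (β * N / l) * Real.exp (l * t) := by
      refine intervalIntegral.norm_integral_le_of_norm_le ha (Eventually.of_forall fun t ht => ?_)
        (Continuous.intervalIntegrable (by fun_prop) _ _)
      have := hφ.abs_volterra_integrand_le hψ hl hN t
      rw [abs_of_pos ht.1] at this
      exact this.trans (le_of_eq (by ring))
    rw [intervalIntegral.integral_const_mul] at hb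
    rw [abs_of_nonneg ha, ← Real.norm_eq_abs]
    refine hb.trans ((mul_le_mul_of_nonneg_left (integral_exp_mul_le hl a) (by positivity)).trans
      (le_of_eq (by field_simp)))

theorem flux_sub (hφ : IsCoeff β φ) {v : ℝ → ℝ} (hu : Continuous u) (hv : Continuous v) (s : ℝ) :
    volterraFlux φ u s - volterraFlux φ v s = volterraFlux φ (fun t => u t - v t) s := by
  unfold volterraFlux
  rw [← intervalIntegral.integral_sub (hφ.intervalIntegrable hu _ _)
    (hφ.intervalIntegrable hv _ _)]
  congr 1
  ext t
  ring

theorem flux_coeff_sub {β' : ℝ} {φ' : ℝ → ℝ} (hφ : IsCoeff β φ) (hφ' : IsCoeff β' φ')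
    (hu : Continuous u) (s : ℝ) :
    volterraFlux φ u s - volterraFlux φ' u s = volterraFlux (fun t => φ t - φ' t) u s := by
  unfold volterraFlux
  rw [← intervalIntegral.integral_sub (hφ.intervalIntegrable hu _ _)
    (hφ'.intervalIntegrable hu _ _)]
  congr 1
  ext t
  ring

theorem volterra_sub (hφ : IsCoeff β φ) (hψm : Measurable ψ) (hψ : ∀ t, |ψ t| ≤ α)
    {v : ℝ → ℝ} {N' : ℝ} (hu : Continuous u) (hv : Continuous v) (hl : 0 < l)
    (hN : ∀ t, |u t| ≤ N * Real.exp (l * |t|)) (hN' : ∀ t, |v t| ≤ N' * Real.exp (l * |t|))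
    (a : ℝ) : volterra ψ φ u a - volterra ψ φ v a = volterra ψ φ (fun t => u t - v t) a := by
  unfold volterra
  rw [← intervalIntegral.integral_sub (hφ.volterra_intervalIntegrable hψm hψ hu hl hN _ _)
    (hφ.volterra_intervalIntegrable hψm hψ hv hl hN' _ _)]
  congr 1
  ext t
  rw [← hφ.flux_sub hu hv]
  ring

/-- Telescoping `ψφ - ψ'φ' = (ψ - ψ')φ + ψ'(φ - φ')`; it isolates the effect of changing the weight.
-/
theorem volterra_coeff_sub {α' β' γ : ℝ} {φ' ψ' : ℝ → ℝ} (hφ : IsCoeff β φ) (hφ' : IsCoeff β' φ')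
    (hψm : Measurable ψ) (hψ : ∀ t, |ψ t| ≤ α) (hψm' : Measurable ψ') (hψ' : ∀ t, |ψ' t| ≤ α')
    (hd : IsCoeff γ (fun t => φ t - φ' t))
    (hu : Continuous u) (hl : 0 < l) (hN : ∀ t, |u t| ≤ N * Real.exp (l * |t|)) (a : ℝ) :
    volterra ψ φ u a - volterra ψ' φ' u a =
      volterra (fun t => ψ t - ψ' t) φ u a + volterra ψ' (fun t => φ t - φ' t) u a := by
  have hd' : ∀ t, |ψ t - ψ' t| ≤ α + α' := fun t =>
    (abs_sub _ _).trans (add_le_add (hψ t) (hψ' t))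
  unfold volterra
  rw [← intervalIntegral.integral_sub (hφ.volterra_intervalIntegrable hψm hψ hu hl hN _ _)
    (hφ'.volterra_intervalIntegrable hψm' hψ' hu hl hN _ _),
    ← intervalIntegral.integral_add
    (hφ.volterra_intervalIntegrable (ψ := fun t => ψ t - ψ' t) (hψm.sub hψm') hd' hu hl hN _ _)
    (hd.volterra_intervalIntegrable hψm' hψ' hu hl hN _ _)]
  congr 1
  ext t
  rw [← hφ.flux_coeff_sub hφ' hu]
  ring

end IsCoeff

/-- A measurable weight with values in `[c, M]`, `c > 0`. -/
structure IsWeight (c M : ℝ) (H : ℝ → ℝ) : Prop where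
  measurable : Measurable H
  pos : 0 < c
  le : ∀ a, c ≤ H a
  le_upper : ∀ a, H a ≤ M

/-- The zeroth-order coefficient `b² / H`, cut off to the positive half line. -/
def potential (b : ℝ) (H : ℝ → ℝ) : ℝ → ℝ := (Ioi (0 : ℝ)).indicator fun t => b ^ 2 / H t

namespace IsWeight

variable {b c M : ℝ} {H H' : ℝ → ℝ}

theorem apply_pos (h : IsWeight c M H) (a : ℝ) : 0 < H a := h.pos.trans_le (h.le a)

theorem abs_inv_le (h : IsWeight c M H) (t : ℝ) : |(H t)⁻¹| ≤ c⁻¹ := by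
  rw [abs_of_pos (inv_pos.2 (h.apply_pos t))]
  exact inv_anti₀ h.pos (h.le t)

theorem abs_inv_sub_inv_le (h : IsWeight c M H) (h' : IsWeight c M H') {ε : ℝ}
    (hε : ∀ t, |H t - H' t| ≤ ε) (t : ℝ) : |(H t)⁻¹ - (H' t)⁻¹| ≤ ε / c * c⁻¹ := by
  have h1 := h.apply_pos t
  have h2 := h'.apply_pos t
  rw [inv_sub_inv h1.ne' h2.ne', abs_div, abs_of_pos (mul_pos h1 h2), abs_sub_comm, div_mul_eq_mul_div,
    mul_comm ε, inv_mul_eq_div, div_div]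
  have := h.pos
  have h0 : 0 ≤ ε := (abs_nonneg _).trans (hε 0)
  exact div_le_div₀ h0 (hε t) (by positivity) (mul_le_mul (h.le t) (h'.le t) this.le h1.le)

theorem isCoeff_potential (h : IsWeight c M H) (b : ℝ) : IsCoeff (b ^ 2 / c) (potential b H) where
  measurable := (measurable_const.div h.measurable).indicator measurableSet_Ioi
  abs_le t := by
    have := h.pos
    unfold potential
    by_cases ht : t ∈ Ioi (0 : ℝ)
    · rw [indicator_of_mem ht, abs_of_nonneg (div_nonneg (sq_nonneg b) (h.apply_pos t).le)]
      exact div_le_div_of_nonneg_left (sq_nonneg b) h.pos (h.le t)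
    · rw [indicator_of_notMem ht, abs_zero]
      positivity
  eq_zero t ht := indicator_of_notMem (by simpa using ht) _

theorem isCoeff_potential_sub (h : IsWeight c M H) (h' : IsWeight c M H') (b : ℝ) {ε : ℝ}
    (hε : ∀ t, |H t - H' t| ≤ ε) :
    IsCoeff (ε / c * (b ^ 2 / c)) (fun t => potential b H t - potential b H' t) where
  measurable := (h.isCoeff_potential b).measurable.sub (h'.isCoeff_potential b).measurable
  abs_le t := by
    have := h.pos
    have h0 : 0 ≤ ε := (abs_nonneg _).trans (hε 0)
    unfold potential
    by_cases ht : t ∈ Ioi (0 : ℝ)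
    · rw [indicator_of_mem ht, indicator_of_mem ht, div_eq_mul_inv, div_eq_mul_inv, ← mul_sub,
        abs_mul, abs_of_nonneg (sq_nonneg b)]
      exact (mul_le_mul_of_nonneg_left (h.abs_inv_sub_inv_le h' hε t) (sq_nonneg b)).trans
        (le_of_eq (by ring))
    · rw [indicator_of_notMem ht, indicator_of_notMem ht, sub_zero, abs_zero]
      positivity
  eq_zero t ht := by
    rw [(h.isCoeff_potential b).eq_zero t ht, (h'.isCoeff_potential b).eq_zero t ht, sub_zero]

end IsWeight

end

end SteklovAux

/-! ### The regular solution: existence, positivity, Lipschitz dependence on the weight. -/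

namespace SteklovAux

noncomputable section

namespace IsWeight

variable {b c M : ℝ} {H H' : ℝ → ℝ}

theorem measurable_inv (h : IsWeight c M H) : Measurable fun t => (H t)⁻¹ := h.measurable.inv

theorem abs_exp_mul_le (l : ℝ) (W : ℝ →ᵇ ℝ) (t : ℝ) :
    |Real.exp (l * |t|) * W t| ≤ ‖W‖ * Real.exp (l * |t|) := by
  rw [abs_mul, Real.abs_exp, mul_comm]
  exact mul_le_mul_of_nonneg_right (W.norm_coe_le_norm t) (Real.exp_pos _).le

theorem continuous_exp_mul (l : ℝ) (W : ℝ →ᵇ ℝ) :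
    Continuous fun t => Real.exp (l * |t|) * W t := by
  have := W.continuous
  fun_prop

/-- The exponent `2b/c` is chosen so that `c⁻¹ · (b²/c) / (2b/c)² = 1/4`, the contraction constant.
-/
theorem abs_weighted_volterra_le (h : IsWeight c M H) (hb : 0 < b) {u : ℝ → ℝ} {N : ℝ}
    (hN : ∀ t, |u t| ≤ N * Real.exp (2 * b / c * |t|)) (a : ℝ) :
    |volterra (fun t => (H t)⁻¹) (potential b H) u a| ≤ N / 4 * Real.exp (2 * b / c * |a|) := by
  have hc := h.pos
  refine ((h.isCoeff_potential b).abs_volterra_le h.abs_inv_le (by positivity) hN a).trans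
    (le_of_eq ?_)
  field_simp
  norm_num

/-- The exponentially weighted Picard operator of the initial value problem at `0`. -/
def picard (h : IsWeight c M H) (hb : 0 < b) (W : ℝ →ᵇ ℝ) : ℝ →ᵇ ℝ :=
  BoundedContinuousFunction.ofNormedAddCommGroup
    (fun a => Real.exp (-(2 * b / c * |a|)) * (1 + volterra (fun t => (H t)⁻¹) (potential b H)
      (fun t => Real.exp (2 * b / c * |t|) * W t) a))
    (by
      have hc := h.pos
      have := (h.isCoeff_potential b).continuous_volterra h.measurable_inv h.abs_inv_le
        (continuous_exp_mul (2 * b / c) W) (by positivity) (abs_exp_mul_le _ W)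
      fun_prop)
    (1 + ‖W‖ / 4) (fun a => by
      have hc := h.pos
      have h1 := h.abs_weighted_volterra_le hb (abs_exp_mul_le _ W) a
      have h2 : (1 : ℝ) ≤ Real.exp (2 * b / c * |a|) := Real.one_le_exp (by positivity)
      rw [norm_mul, Real.norm_eq_abs, Real.norm_eq_abs, Real.abs_exp, Real.exp_neg,
        inv_mul_le_iff₀ (Real.exp_pos _)]
      refine (abs_add_le _ _).trans ?_
      rw [abs_one]
      linarith)

theorem picard_apply (h : IsWeight c M H) (hb : 0 < b) (W : ℝ →ᵇ ℝ) (a : ℝ) :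
    h.picard hb W a = Real.exp (-(2 * b / c * |a|)) * (1 + volterra (fun t => (H t)⁻¹)
      (potential b H) (fun t => Real.exp (2 * b / c * |t|) * W t) a) := rfl

theorem picard_contracting (h : IsWeight c M H) (hb : 0 < b) :
    ContractingWith (1 / 4) (h.picard hb) := by
  refine ⟨by rw [← NNReal.coe_lt_coe]; norm_num, LipschitzWith.of_dist_le_mul fun W V => ?_⟩
  have hc := h.pos
  refine (BoundedContinuousFunction.dist_le (by positivity)).2 fun a => ?_
  rw [Real.dist_eq, picard_apply, picard_apply, ← mul_sub, add_sub_add_left_eq_sub,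
    (h.isCoeff_potential b).volterra_sub h.measurable_inv h.abs_inv_le (continuous_exp_mul _ W)
      (continuous_exp_mul _ V) (show 0 < 2 * b / c by positivity) (abs_exp_mul_le _ W)
      (abs_exp_mul_le _ V), abs_mul, Real.abs_exp, Real.exp_neg,
    inv_mul_le_iff₀ (Real.exp_pos _)]
  have := h.abs_weighted_volterra_le hb (N := ‖W - V‖)
    (u := fun t => Real.exp (2 * b / c * |t|) * W t - Real.exp (2 * b / c * |t|) * V t)
    (fun t => by rw [← mul_sub]; exact abs_exp_mul_le _ (W - V) t) a
  rw [dist_eq_norm]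
  refine this.trans (le_of_eq ?_)
  simp
  ring

/-- The fixed point of the Picard operator. -/
def picardFix (h : IsWeight c M H) (hb : 0 < b) : ℝ →ᵇ ℝ :=
  ContractingWith.fixedPoint _ (h.picard_contracting hb)

/-- The solution `X` of `X = 1 + ∫ Y / (s H)`, `Y = ∫ b² t X / H`. -/
def sol (h : IsWeight c M H) (hb : 0 < b) (a : ℝ) : ℝ :=
  Real.exp (2 * b / c * |a|) * h.picardFix hb a

/-- The flux `Y = ∫ b² t X / H` of the solution `X`. -/
def solFlux (h : IsWeight c M H) (hb : 0 < b) : ℝ → ℝ := volterraFlux (potential b H) (h.sol hb)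

theorem picard_picardFix (h : IsWeight c M H) (hb : 0 < b) :
    h.picard hb (h.picardFix hb) = h.picardFix hb :=
  ContractingWith.fixedPoint_isFixedPt _

theorem continuous_sol (h : IsWeight c M H) (hb : 0 < b) : Continuous (h.sol hb) :=
  continuous_exp_mul _ _

theorem continuous_solFlux (h : IsWeight c M H) (hb : 0 < b) : Continuous (h.solFlux hb) :=
  (h.isCoeff_potential b).continuous_flux (h.continuous_sol hb)

theorem sol_eq (h : IsWeight c M H) (hb : 0 < b) (a : ℝ) :
    h.sol hb a = 1 + ∫ s in (0 : ℝ)..a, (H s)⁻¹ * (h.solFlux hb s / s) := by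
  have := DFunLike.congr_fun (h.picard_picardFix hb) a
  rw [picard_apply, Real.exp_neg, inv_mul_eq_iff_eq_mul₀ (Real.exp_ne_zero _)] at this
  exact this.symm

theorem solFlux_eq (h : IsWeight c M H) (hb : 0 < b) (s : ℝ) :
    h.solFlux hb s = ∫ t in (0 : ℝ)..s, potential b H t * (t * h.sol hb t) := rfl

/-- Starting from `0`, the first iterate has norm at most `1`, and `1 / (1 - 1/4) = 4/3`. -/
theorem norm_picardFix_le (h : IsWeight c M H) (hb : 0 < b) : ‖h.picardFix hb‖ ≤ 4 / 3 := by
  have hc := h.pos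
  have h1 := (h.picard_contracting hb).dist_fixedPoint_le 0
  have h2 : dist 0 (h.picard hb 0) ≤ 1 := by
    rw [dist_comm]
    refine (BoundedContinuousFunction.dist_le zero_le_one).2 fun a => ?_
    have : volterra (fun t => (H t)⁻¹) (potential b H) (fun t => 0) a = 0 := by
      simp [volterra, volterraFlux]
    rw [picard_apply]
    simp only [BoundedContinuousFunction.coe_zero, Pi.zero_apply, mul_zero, this, add_zero, mul_one,
      dist_zero_right, Real.norm_eq_abs, Real.abs_exp]
    exact Real.exp_le_one_iff.2 (by simp only [Left.neg_nonpos_iff]; positivity)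
  rw [dist_comm, dist_zero_right] at h1
  refine h1.trans ?_
  rw [div_le_iff₀ (by norm_num)]
  push_cast
  linarith

theorem abs_sol_le (h : IsWeight c M H) (hb : 0 < b) (t : ℝ) :
    |h.sol hb t| ≤ 4 / 3 * Real.exp (2 * b / c * |t|) :=
  (abs_exp_mul_le _ _ t).trans
    (mul_le_mul_of_nonneg_right (h.norm_picardFix_le hb) (Real.exp_pos _).le)

theorem volterraFlux_nonneg (h : IsWeight c M H) {u : ℝ → ℝ} (hu : ∀ t, 0 ≤ u t) (s : ℝ) :
    0 ≤ volterraFlux (potential b H) u s := by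
  rcases le_total s 0 with hs | hs
  · rw [(h.isCoeff_potential b).flux_eq_zero hs]
  · refine intervalIntegral.integral_nonneg hs fun t ht => mul_nonneg ?_ (mul_nonneg ht.1 (hu t))
    exact indicator_nonneg (fun t _ => div_nonneg (sq_nonneg b) (h.apply_pos t).le) t

theorem volterra_nonneg (h : IsWeight c M H) {u : ℝ → ℝ} (hu : ∀ t, 0 ≤ u t) (a : ℝ) :
    0 ≤ volterra (fun t => (H t)⁻¹) (potential b H) u a := by
  rcases le_total a 0 with ha | ha
  · refine le_of_eq (intervalIntegral.integral_zero_ae (Eventually.of_forall fun t ht => ?_)).symm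
    rw [uIoc_of_ge ha] at ht
    rw [(h.isCoeff_potential b).flux_eq_zero ht.2, zero_div, mul_zero]
  · exact intervalIntegral.integral_nonneg ha fun t ht => mul_nonneg
      (inv_nonneg.2 (h.apply_pos t).le) (div_nonneg (h.volterraFlux_nonneg hu t) ht.1)

/-- The Picard operator preserves nonnegativity, and the iterates starting at `0` converge to the
fixed point. -/
theorem picardFix_nonneg (h : IsWeight c M H) (hb : 0 < b) (t : ℝ) : 0 ≤ h.picardFix hb t := by
  have h1 := (h.picard_contracting hb).tendsto_iterate_fixedPoint 0
  have h2 : Tendsto (fun n => (h.picard hb)^[n] 0 t) atTop (𝓝 (h.picardFix hb t)) :=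
    (BoundedContinuousFunction.tendsto_iff_tendstoUniformly.1 h1).tendsto_at t
  refine ge_of_tendsto' h2 fun n => ?_
  induction n generalizing t with
  | zero => simp
  | succ n ih =>
    rw [Function.iterate_succ_apply', picard_apply]
    have := h.volterra_nonneg (b := b) (u := fun t => Real.exp (2 * b / c * |t|) *
      ((h.picard hb)^[n] 0) t) (fun t => mul_nonneg (Real.exp_pos _).le (ih t
        ((BoundedContinuousFunction.tendsto_iff_tendstoUniformly.1 h1).tendsto_at t))) t
    positivity

theorem sol_nonneg (h : IsWeight c M H) (hb : 0 < b) (t : ℝ) : 0 ≤ h.sol hb t :=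
  mul_nonneg (Real.exp_pos _).le (h.picardFix_nonneg hb t)

theorem solFlux_nonneg (h : IsWeight c M H) (hb : 0 < b) (s : ℝ) : 0 ≤ h.solFlux hb s :=
  h.volterraFlux_nonneg (h.sol_nonneg hb) s

theorem one_le_sol (h : IsWeight c M H) (hb : 0 < b) (a : ℝ) : 1 ≤ h.sol hb a := by
  rw [sol_eq, le_add_iff_nonneg_right]
  exact h.volterra_nonneg (h.sol_nonneg hb) a

/-- Lipschitz dependence of the solution on the weight. -/
theorem abs_sol_sub_le (h : IsWeight c M H) (h' : IsWeight c M H') (hb : 0 < b) {ε : ℝ}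
    (hε : ∀ t, |H t - H' t| ≤ ε) (a : ℝ) :
    |h.sol hb a - h'.sol hb a| ≤ 8 / 9 * (ε / c) * Real.exp (2 * b / c * |a|) := by
  have hc := h.pos
  have h0 : 0 ≤ ε := (abs_nonneg _).trans (hε 0)
  have hl : 0 < 2 * b / c := by positivity
  set V := h'.picardFix hb with hV
  have hN := h'.abs_sol_le hb
  -- Each telescoped term contributes `(1/4) · (4/3) · ε/c`.
  have h1 : dist (h.picard hb V) (h'.picard hb V) ≤ 2 / 3 * (ε / c) := by
    refine (BoundedContinuousFunction.dist_le (by positivity)).2 fun a => ?_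
    rw [Real.dist_eq, picard_apply, picard_apply, ← mul_sub, add_sub_add_left_eq_sub,
      (h.isCoeff_potential b).volterra_coeff_sub (h'.isCoeff_potential b) h.measurable_inv
        h.abs_inv_le h'.measurable_inv h'.abs_inv_le (h.isCoeff_potential_sub h' b hε)
        (continuous_exp_mul _ V) hl hN, abs_mul, Real.abs_exp, Real.exp_neg,
      inv_mul_le_iff₀ (Real.exp_pos _)]
    have e1 := (h.isCoeff_potential b).abs_volterra_le (h.abs_inv_sub_inv_le h' hε) hl hN a
    have e2 := (h.isCoeff_potential_sub h' b hε).abs_volterra_le h'.abs_inv_le hl hN a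
    refine (abs_add_le _ _).trans ((add_le_add e1 e2).trans (le_of_eq ?_))
    field_simp
    ring
  have h2 := (h.picard_contracting hb).dist_le_of_fixedPoint V
    (ContractingWith.fixedPoint_isFixedPt (h.picard_contracting hb))
  -- The a priori contraction estimate divides by `1 - 1/4`, whence `8/9`.
  have h3 : dist V (h.picardFix hb) ≤ 8 / 9 * (ε / c) := by
    refine h2.trans ?_
    rw [div_le_iff₀ (by norm_num), dist_comm]
    have h4 : h'.picard hb V = V := h'.picard_picardFix hb
    rw [h4] at h1
    refine h1.trans (le_of_eq ?_)
    push_cast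
    ring
  unfold sol
  rw [← mul_sub, abs_mul, Real.abs_exp, mul_comm]
  refine mul_le_mul_of_nonneg_right ?_ (Real.exp_pos _).le
  refine le_trans ?_ h3
  rw [dist_comm, ← Real.dist_eq]
  exact BoundedContinuousFunction.dist_coe_le_dist a

/-- The change of solution contributes `8/9` and the change of potential `4/3`; together `20/9`. -/
theorem abs_solFlux_sub_le (h : IsWeight c M H) (h' : IsWeight c M H') (hb : 0 < b) {ε : ℝ}
    (hε : ∀ t, |H t - H' t| ≤ ε) (s : ℝ) :
    |h.solFlux hb s - h'.solFlux hb s| ≤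
      ε * (|s| * (20 / 9 * (b ^ 2 / c ^ 2) * Real.exp (2 * b / c * |s|) / (2 * b / c))) := by
  have hc := h.pos
  have hl : 0 < 2 * b / c := by positivity
  have e1 := (h.isCoeff_potential b).abs_flux_le hl (h.abs_sol_sub_le h' hb hε) s
  have e2 := (h.isCoeff_potential_sub h' b hε).abs_flux_le hl (h'.abs_sol_le hb) s
  rw [← (h.isCoeff_potential b).flux_sub (h.continuous_sol hb) (h'.continuous_sol hb)] at e1
  rw [← (h.isCoeff_potential b).flux_coeff_sub (h'.isCoeff_potential b)
    (h'.continuous_sol hb)] at e2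
  have := (abs_add_le _ _).trans (add_le_add e1 e2)
  rw [sub_add_sub_cancel] at this
  refine this.trans (le_of_eq ?_)
  field_simp
  ring

end IsWeight

end

end SteklovAux

/-! ### Picone's inequality, the value of `κ₁`, and uniqueness of the solution. -/

namespace SteklovAux

noncomputable section

theorem MemWeightedL2.integrableOn {A : ℝ} {w : ℝ → ℝ} {f : ℝ → ℂ} (hf : MemWeightedL2 A w f)
    (hw : Measurable w) (hw0 : ∀ a ∈ Ioo 0 A, 0 ≤ w a) :
    IntegrableOn (fun a => w a * ‖f a‖ ^ 2) (Ioo 0 A) := by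
  have h1 : Integrable (fun a => ‖f a‖ ^ 2)
      ((volume.restrict (Ioo 0 A)).withDensity fun a => ENNReal.ofReal (w a)) :=
    hf.integrable_norm_pow (by norm_num)
  rw [integrable_withDensity_iff_integrable_smul' hw.ennreal_ofReal
    (Eventually.of_forall fun _ => ENNReal.ofReal_lt_top)] at h1
  refine h1.congr ?_
  filter_upwards [ae_restrict_mem measurableSet_Ioo] with a ha
  rw [ENNReal.toReal_ofReal (hw0 a ha), smul_eq_mul]

theorem memWeightedL2_of_bound {A : ℝ} {w : ℝ → ℝ} {f : ℝ → ℂ} {C K : ℝ} (hw : Measurable w)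
    (hwK : ∀ a ∈ Ioo 0 A, |w a| ≤ K) (hf : Measurable f) (hC : ∀ a ∈ Ioo 0 A, ‖f a‖ ≤ C) :
    MemWeightedL2 A w f := by
  have hwi : IntegrableOn w (Ioo 0 A) :=
    Measure.integrableOn_of_bounded (M := K) (by simp) hw.aestronglyMeasurable
      ((ae_restrict_mem measurableSet_Ioo).mono hwK)
  have := isFiniteMeasure_withDensity_ofReal hwi.2
  exact MemLp.of_bound hf.aestronglyMeasurable C
    ((withDensity_absolutelyContinuous _ _).ae_le
      ((ae_restrict_mem measurableSet_Ioo).mono hC))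

theorem memL2_of_bound {A : ℝ} {f : ℝ → ℂ} {C : ℝ} (hf : Measurable f)
    (hC : ∀ a ∈ Ioo 0 A, ‖f a‖ ≤ C) : MemL2 A f :=
  MemLp.of_bound hf.aestronglyMeasurable C ((ae_restrict_mem measurableSet_Ioo).mono hC)

/-- Away from `0` the weight is at least `c x`, and `|f| ≤ 1 + |f|²` on a bounded interval. -/
theorem integrableOn_Ioo_of_weighted {A c x : ℝ} {w : ℝ → ℝ} {f : ℝ → ℂ} (hc : 0 < c) (hx : 0 < x)
    (hw : ∀ a ∈ Ioo 0 A, c * a ≤ w a) (hf : LocallyIntegrableOn f (Ioo 0 A))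
    (hi : IntegrableOn (fun a => w a * ‖f a‖ ^ 2) (Ioo 0 A)) : IntegrableOn f (Ioo x A) := by
  have hsub : Ioo x A ⊆ Ioo 0 A := Ioo_subset_Ioo_left hx.le
  have h1 : IntegrableOn (fun a => 1 + (c * x)⁻¹ * (w a * ‖f a‖ ^ 2)) (Ioo x A) :=
    (integrableOn_const (by simp)).add ((hi.mono_set hsub).const_mul _)
  refine Integrable.mono' h1 (hf.aestronglyMeasurable.mono_measure
    (Measure.restrict_mono hsub le_rfl)) ?_
  filter_upwards [ae_restrict_mem measurableSet_Ioo] with a ha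
  have h2 : c * x ≤ w a := (mul_le_mul_of_nonneg_left ha.1.le hc.le).trans (hw a (hsub ha))
  have h3 : ‖f a‖ ^ 2 ≤ (c * x)⁻¹ * (w a * ‖f a‖ ^ 2) := by
    rw [← mul_assoc, inv_mul_eq_div]
    exact le_mul_of_one_le_left (sq_nonneg _) ((one_le_div (by positivity)).2 h2)
  nlinarith [sq_nonneg (‖f a‖ - 1), norm_nonneg (f a)]

/-- If `u` is integrable near `0`, then `x u(x)` cannot be bounded below by a positive constant. -/
theorem nonpos_of_forall_le_mul {A δ : ℝ} (hA : 0 < A) {u : ℝ → ℝ} (hu : IntegrableOn u (Ioo 0 A))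
    (h : ∀ᵐ x ∂(volume.restrict (Ioo 0 A)), δ ≤ x * u x) : δ ≤ 0 := by
  by_contra! hδ
  -- If `δ > 0`, then `u / δ` dominates `1 / x`.
  have h1 : IntegrableOn (fun x : ℝ => x ^ (-1 : ℝ)) (Ioo 0 A) := by
    refine Integrable.mono' (hu.const_mul δ⁻¹) (by fun_prop) ?_
    filter_upwards [h, ae_restrict_mem measurableSet_Ioo] with x hx hm
    rw [Real.rpow_neg_one, Real.norm_eq_abs, abs_of_pos (inv_pos.2 hm.1), inv_mul_eq_div,
      le_div_iff₀ hδ, inv_mul_le_iff₀ hm.1]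
    exact hx
  rw [intervalIntegral.integrableOn_Ioo_rpow_iff hA] at h1
  exact lt_irrefl _ h1

namespace IsWeight

variable {b c M A : ℝ} {H : ℝ → ℝ}

theorem hasACDeriv_sol (h : IsWeight c M H) (hb : 0 < b) {x y : ℝ} (hx : 0 ≤ x) (hxy : x ≤ y) :
    HasACDeriv (h.sol hb) (fun s => (H s)⁻¹ * (h.solFlux hb s / s)) x y := by
  have hc := h.pos
  have hi := (h.isCoeff_potential b).volterra_intervalIntegrable h.measurable_inv h.abs_inv_le
    (h.continuous_sol hb) (show 0 < 2 * b / c by positivity) (h.abs_sol_le hb) 0 y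
  have h0 : HasACDeriv (fun a => 1 + ∫ s in (0 : ℝ)..a, (H s)⁻¹ * (h.solFlux hb s / s))
      (fun s => 0 + (H s)⁻¹ * (h.solFlux hb s / s)) 0 y :=
    (HasACDeriv.const 1 0 y).add (HasACDeriv.intervalIntegral hi left_mem_uIcc)
  refine HasACDeriv.congr hxy (F := fun a => 1 + ∫ s in (0 : ℝ)..a, (H s)⁻¹ * (h.solFlux hb s / s))
    ?_ fun a _ => h.sol_eq hb a
  simp only [zero_add] at h0
  refine h0.mono ?_
  rw [uIcc_of_le hxy, uIcc_of_le (hx.trans hxy)]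
  exact Icc_subset_Icc_left hx

theorem hasACDeriv_solFlux (h : IsWeight c M H) (hb : 0 < b) {x y : ℝ} (hx : 0 ≤ x) (hxy : x ≤ y) :
    HasACDeriv (h.solFlux hb) (fun t => b ^ 2 * t / H t * h.sol hb t) x y := by
  have hi := (h.isCoeff_potential b).intervalIntegrable (h.continuous_sol hb) 0 y
  have h0 : HasACDeriv (h.solFlux hb) _ 0 y := HasACDeriv.intervalIntegral hi left_mem_uIcc
  have hs : uIcc x y ⊆ uIcc 0 y := by
    rw [uIcc_of_le hxy, uIcc_of_le (hx.trans hxy)]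
    exact Icc_subset_Icc_left hx
  refine (h0.mono hs).congr_deriv (Eventually.of_forall fun t ht => ?_)
  rw [uIcc_of_le hxy] at ht
  -- At `t = 0` the cut-off potential is `0`, but both expressions carry a factor `t`.
  rcases (hx.trans ht.1).eq_or_lt with h0 | h0
  · simp [← h0]
  · rw [potential, indicator_of_mem (show t ∈ Ioi (0 : ℝ) from h0)]
    ring

theorem sol_le (h : IsWeight c M H) (hb : 0 < b) {t : ℝ} (ht : t ∈ Icc 0 A) :
    h.sol hb t ≤ 4 / 3 * Real.exp (2 * b / c * A) := by
  have hc := h.pos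
  refine (le_abs_self _).trans ((h.abs_sol_le hb t).trans ?_)
  rw [abs_of_nonneg ht.1]
  gcongr
  exact ht.2

/-- Linear decay of the flux at `0` controls Picone's boundary term, bounds the derivative of the
solution, and tames the `1 / a` in the derivative formula. -/
theorem solFlux_le (h : IsWeight c M H) (hb : 0 < b) {t : ℝ} (ht : t ∈ Icc 0 A) :
    h.solFlux hb t ≤ (b ^ 2 / c * (4 / 3) * Real.exp (2 * b / c * A) / (2 * b / c)) * t := by
  have hc := h.pos
  refine (le_abs_self _).trans (((h.isCoeff_potential b).abs_flux_le
    (show 0 < 2 * b / c by positivity) (h.abs_sol_le hb) t).trans ?_)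
  rw [abs_of_nonneg ht.1, mul_comm]
  have := ht.1
  gcongr
  exact ht.2

theorem energy_integrableOn (h : IsWeight c M H) {f f' : ℝ → ℂ}
    (hf : MemSpace A (fun a => a * H a) f f') :
    IntegrableOn (fun a => a * H a * ‖f' a‖ ^ 2 + b ^ 2 * a / H a * ‖f a‖ ^ 2) (Ioo 0 A) := by
  have hc := h.pos
  refine (hf.2.2.integrableOn (measurable_id.mul h.measurable)
    fun a ha => mul_nonneg ha.1.le (h.apply_pos a).le).add ?_
  have h1 : IntegrableOn (fun a => ‖f a‖ ^ 2) (Ioo 0 A) := hf.1.integrable_norm_pow (by norm_num)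
  refine Integrable.bdd_mul (c := b ^ 2 * A / c) h1
    (Measurable.aestronglyMeasurable
    (by have := h.measurable; fun_prop)) ?_
  filter_upwards [ae_restrict_mem measurableSet_Ioo] with a ha
  have ha0 := ha.1
  have := h.apply_pos a
  have hA : 0 < A := ha.1.trans ha.2
  rw [Real.norm_eq_abs, abs_of_nonneg (by positivity)]
  exact div_le_div₀ (by positivity) (by gcongr; exact ha.2.le) hc (h.le a)

/-- Picone's inequality on `[x, A]`. -/
theorem picone (h : IsWeight c M H) (hb : 0 < b) {f f' F : ℝ → ℂ}
    (hf : MemSpace A (fun a => a * H a) f f') (hF : IsContRep A f F) {x : ℝ} (hx : x ∈ Ioo 0 A) :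
    h.solFlux hb A / h.sol hb A * ‖F A‖ ^ 2 - h.solFlux hb x / h.sol hb x * ‖F x‖ ^ 2 ≤
      energy b A H f f' := by
  have hA : 0 < A := hx.1.trans hx.2
  have hFac : HasACDeriv F f' x A := hf.2.1.hasACDeriv hA hF (fun x hx _ =>
    integrableOn_Ioo_of_weighted h.pos hx
      (fun a ha => by rw [mul_comm]; exact mul_le_mul_of_nonneg_left (h.le a) ha.1.le) hf.2.1.2.1
      (hf.2.2.integrableOn (measurable_id.mul h.measurable)
        fun a ha => mul_nonneg ha.1.le (h.apply_pos a).le)) x hx.1 hx.2.le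
  -- The function to be differentiated is `(Y / X) |F|²`.
  have hr := (h.hasACDeriv_solFlux hb hx.1.le hx.2.le).mul
    ((h.hasACDeriv_sol hb hx.1.le hx.2.le).inv_of_one_le fun _ _ => h.one_le_sol hb _)
  have hn := (hFac.re.mul hFac.re).add (hFac.im.mul hFac.im)
  have hall := hr.mul hn
  have hE := h.energy_integrableOn (b := b) hf
  have hE' := (intervalIntegrable_iff_integrableOn_Ioo_of_le hx.2.le).2
    (hE.mono_set (Ioo_subset_Ioo_left hx.1.le))
  have hnorm : ∀ w : ℂ, ‖w‖ ^ 2 = w.re * w.re + w.im * w.im := fun w => by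
    rw [← Complex.normSq_eq_norm_sq, Complex.normSq_apply]
  have key := intervalIntegral.integral_mono_ae_restrict hx.2.le hall.intervalIntegrable hE' (by
    have hae := hF.2
    rw [Measure.restrict_congr_set (Ioo_ae_eq_Ioc (μ := volume))] at hae
    have hsub : Ioc x A ⊆ Ioc 0 A := Ioc_subset_Ioc_left hx.1.le
    rw [← Measure.restrict_congr_set (Ioc_ae_eq_Icc (μ := volume))]
    filter_upwards [ae_restrict_of_ae_restrict_of_subset hsub hae,
      ae_restrict_mem measurableSet_Ioc] with t ht htm
    have ht0 : 0 < t := hx.1.trans htm.1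
    have hHt := h.apply_pos t
    have hX : 0 < h.sol hb t := by linarith [h.one_le_sol hb t]
    rw [← ht, hnorm, hnorm]
    generalize h.sol hb t = X at *
    generalize h.solFlux hb t = Y at *
    generalize H t = p at *
    rw [← sub_nonneg]
    -- Picone's identity: the difference is `t p |f' - Y F / (t p X)|²`.
    have : t * p * ((f' t).re * (f' t).re + (f' t).im * (f' t).im) +
        b ^ 2 * t / p * ((F t).re * (F t).re + (F t).im * (F t).im) -
        ((b ^ 2 * t / p * X * X⁻¹ + Y * (-(p⁻¹ * (Y / t)) / X ^ 2)) *
            ((F t).re * (F t).re + (F t).im * (F t).im) +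
          Y * X⁻¹ * ((f' t).re * (F t).re + (F t).re * (f' t).re +
            ((f' t).im * (F t).im + (F t).im * (f' t).im))) =
        t * p * (((f' t).re - Y / (t * p * X) * (F t).re) ^ 2 +
          ((f' t).im - Y / (t * p * X) * (F t).im) ^ 2) := by
      field_simp
      ring
    rw [this]
    positivity)
  rw [hall.integral_eq] at key
  simp only [← hnorm] at key
  rw [div_eq_mul_inv, div_eq_mul_inv]
  refine key.trans ?_
  rw [intervalIntegral.integral_of_le hx.2.le, integral_Ioc_eq_integral_Ioo]
  refine setIntegral_mono_set hE ?_ (Ioo_subset_Ioo_left hx.1.le).eventuallyLE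
  filter_upwards [ae_restrict_mem measurableSet_Ioo] with a ha
  have ha0 := ha.1
  have := h.apply_pos a
  simp only [Pi.zero_apply]
  positivity

/-- By Picone, a positive gap between the two sides would bound `K x |F x|²` from below for a.e.
`x`, contradicting `f ∈ L²`. -/
theorem solFlux_div_sol_mul_le_energy (h : IsWeight c M H) (hb : 0 < b) (hA : 0 < A)
    {f f' F : ℝ → ℂ} (hf : MemSpace A (fun a => a * H a) f f') (hF : IsContRep A f F) :
    h.solFlux hb A / h.sol hb A * ‖F A‖ ^ 2 ≤ energy b A H f f' := by
  have hc := h.pos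
  set K := b ^ 2 / c * (4 / 3) * Real.exp (2 * b / c * A) / (2 * b / c)
  have h1 : IntegrableOn (fun a => ‖f a‖ ^ 2) (Ioo 0 A) := hf.1.integrable_norm_pow (by norm_num)
  rw [← sub_nonpos]
  refine nonpos_of_forall_le_mul hA (h1.const_mul K) ?_
  filter_upwards [hF.2, ae_restrict_mem measurableSet_Ioo] with x hx hm
  have hp := h.picone hb hf hF hm
  have h2 : h.solFlux hb x / h.sol hb x ≤ K * x :=
    (div_le_self (h.solFlux_nonneg hb x) (h.one_le_sol hb x)).trans
      (h.solFlux_le hb ⟨hm.1.le, hm.2.le⟩)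
  have h3 := mul_le_mul_of_nonneg_right h2 (sq_nonneg ‖F x‖)
  rw [← hx]
  linarith

/-- The solution normalised by its value at `A`. -/
def normSol (h : IsWeight c M H) (hb : 0 < b) (A a : ℝ) : ℝ := h.sol hb a / h.sol hb A

/-- The flux of the normalised solution. -/
def normFlux (h : IsWeight c M H) (hb : 0 < b) (A a : ℝ) : ℝ := h.solFlux hb a / h.sol hb A

theorem sol_pos (h : IsWeight c M H) (hb : 0 < b) (a : ℝ) : 0 < h.sol hb a :=
  zero_lt_one.trans_le (h.one_le_sol hb a)

theorem normSol_self (h : IsWeight c M H) (hb : 0 < b) : h.normSol hb A A = 1 :=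
  div_self (h.sol_pos hb A).ne'

theorem normFlux_zero (h : IsWeight c M H) (hb : 0 < b) : h.normFlux hb A 0 = 0 := by
  rw [normFlux, solFlux_eq, intervalIntegral.integral_same, zero_div]

theorem continuous_normSol (h : IsWeight c M H) (hb : 0 < b) : Continuous (h.normSol hb A) :=
  (h.continuous_sol hb).div_const _

theorem continuous_normFlux (h : IsWeight c M H) (hb : 0 < b) : Continuous (h.normFlux hb A) :=
  (h.continuous_solFlux hb).div_const _

theorem hasACDeriv_normSol (h : IsWeight c M H) (hb : 0 < b) {x y : ℝ} (hx : 0 ≤ x) (hxy : x ≤ y) :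
    HasACDeriv (h.normSol hb A) (fun s => (H s)⁻¹ * (h.normFlux hb A s / s)) x y := by
  have := (h.hasACDeriv_sol hb hx hxy).const_mul (h.sol hb A)⁻¹
  have e : h.normSol hb A = fun x => (h.sol hb A)⁻¹ * h.sol hb x :=
    funext fun x => div_eq_inv_mul _ _
  rw [e]
  refine this.congr_deriv (Eventually.of_forall fun t _ => ?_)
  simp only [normFlux]
  ring

theorem hasACDeriv_normFlux (h : IsWeight c M H) (hb : 0 < b) {x y : ℝ} (hx : 0 ≤ x)
    (hxy : x ≤ y) :
    HasACDeriv (h.normFlux hb A) (fun t => b ^ 2 * t / H t * h.normSol hb A t) x y := by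
  have := (h.hasACDeriv_solFlux hb hx hxy).const_mul (h.sol hb A)⁻¹
  have e : h.normFlux hb A = fun x => (h.sol hb A)⁻¹ * h.solFlux hb x :=
    funext fun x => div_eq_inv_mul _ _
  rw [e]
  refine this.congr_deriv (Eventually.of_forall fun t _ => ?_)
  simp only [normSol]
  ring

theorem abs_normSol_le (h : IsWeight c M H) (hb : 0 < b) {t : ℝ} (ht : t ∈ Icc 0 A) :
    |h.normSol hb A t| ≤ 4 / 3 * Real.exp (2 * b / c * A) := by
  rw [normSol, abs_of_nonneg (div_nonneg (h.sol_nonneg hb t) (h.sol_nonneg hb A))]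
  exact (div_le_self (h.sol_nonneg hb t) (h.one_le_sol hb A)).trans (h.sol_le hb ht)

theorem abs_normFlux_le (h : IsWeight c M H) (hb : 0 < b) {t : ℝ} (ht : t ∈ Icc 0 A) :
    |h.normFlux hb A t| ≤ (b ^ 2 / c * (4 / 3) * Real.exp (2 * b / c * A) / (2 * b / c)) * t := by
  rw [normFlux, abs_of_nonneg (div_nonneg (h.solFlux_nonneg hb t) (h.sol_nonneg hb A))]
  exact (div_le_self (h.solFlux_nonneg hb t) (h.one_le_sol hb A)).trans (h.solFlux_le hb ht)

/-- The normalised solution as a complex-valued function. -/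
def solC (h : IsWeight c M H) (hb : 0 < b) (A a : ℝ) : ℂ := (h.normSol hb A a : ℂ)

/-- The derivative of the normalised solution as a complex-valued function. -/
def solC' (h : IsWeight c M H) (hb : 0 < b) (A a : ℝ) : ℂ :=
  ((H a)⁻¹ * (h.normFlux hb A a / a) : ℝ)

theorem isContRep_solC (h : IsWeight c M H) (hb : 0 < b) :
    IsContRep A (h.solC hb A) (h.solC hb A) :=
  ⟨(Complex.continuous_ofReal.comp (h.continuous_normSol hb)).continuousOn, EventuallyEq.rfl⟩

theorem hasWeakDeriv_solC (h : IsWeight c M H) (hb : 0 < b) (hA : 0 < A) :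
    HasWeakDeriv A (h.solC hb A) (h.solC' hb A) :=
  hasWeakDeriv_of_hasACDeriv hA fun _ _ hx hxy _ => (h.hasACDeriv_normSol hb hx.le hxy).ofReal

/-- The solution and its derivative are bounded, so any bounded weight works; it is applied with `a
H(a)` for the variational problem and with `a` for the system. -/
theorem memSpace_solC (h : IsWeight c M H) (hb : 0 < b) (hA : 0 < A) {w : ℝ → ℝ} {K : ℝ}
    (hw : Measurable w) (hwK : ∀ a ∈ Ioo 0 A, |w a| ≤ K) :
    MemSpace A w (h.solC hb A) (h.solC' hb A) := by
  have hc := h.pos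
  refine ⟨memL2_of_bound (C := 4 / 3 * Real.exp (2 * b / c * A))
    (Complex.measurable_ofReal.comp (h.continuous_normSol hb).measurable) fun a ha => ?_,
    h.hasWeakDeriv_solC hb hA, memWeightedL2_of_bound
      (C := c⁻¹ * (b ^ 2 / c * (4 / 3) * Real.exp (2 * b / c * A) / (2 * b / c))) hw hwK
      (Complex.measurable_ofReal.comp (h.measurable_inv.mul
        ((h.continuous_normFlux hb).measurable.div measurable_id))) fun a ha => ?_⟩
  · rw [solC, Complex.norm_real]
    exact h.abs_normSol_le hb ⟨ha.1.le, ha.2.le⟩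
  · rw [solC', Complex.norm_real, norm_mul]
    refine mul_le_mul (h.abs_inv_le a) ?_ (norm_nonneg _) (by positivity)
    rw [Real.norm_eq_abs, abs_div, abs_of_pos ha.1, div_le_iff₀ ha.1]
    exact h.abs_normFlux_le hb ⟨ha.1.le, ha.2.le⟩

/-- The energy density is `(X Y)'`, with `Y 0 = 0` and `X A = 1`. -/
theorem energy_solC (h : IsWeight c M H) (hb : 0 < b) (hA : 0 < A) :
    energy b A H (h.solC hb A) (h.solC' hb A) = h.normFlux hb A A := by
  have hd := ((h.hasACDeriv_normSol (A := A) hb le_rfl hA.le).mul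
    (h.hasACDeriv_normFlux (A := A) hb le_rfl hA.le)).integral_eq
  rw [h.normFlux_zero, h.normSol_self, one_mul, mul_zero, sub_zero,
    intervalIntegral.integral_of_le hA.le, integral_Ioc_eq_integral_Ioo] at hd
  rw [← hd]
  refine setIntegral_congr_fun measurableSet_Ioo fun a ha => ?_
  have h0 := (h.apply_pos a).ne'
  have h1 := ha.1.ne'
  simp only [solC, solC', Complex.norm_real, Real.norm_eq_abs, sq_abs]
  field_simp

theorem kappaOne_eq (h : IsWeight c M H) (hb : 0 < b) (hA : 0 < A) :
    kappaOne b A H = h.normFlux hb A A := by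
  refine IsLeast.csInf_eq ⟨⟨h.solC hb A, h.solC' hb A, h.solC hb A,
    h.memSpace_solC hb hA (K := A * M) (measurable_id.mul h.measurable) fun a ha => ?_,
    h.isContRep_solC hb, ?_, ?_⟩, ?_⟩
  · have := h.apply_pos a
    simp only [abs_mul]
    rw [abs_of_pos ha.1, abs_of_pos this]
    exact mul_le_mul ha.2.le (h.le_upper a) this.le hA.le
  · simp [solC, h.normSol_self]
  · rw [h.energy_solC hb hA]
    simp [solC, h.normSol_self]
  · rintro q ⟨f, f', F, hf, hF, hne, rfl⟩
    have hp : 0 < ‖F A‖ := norm_pos_iff.2 hne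
    rw [le_div_iff₀ (by positivity)]
    exact h.solFlux_div_sol_mul_le_energy hb hA hf hF

theorem flux_solC' (h : IsWeight c M H) (hb : 0 < b) {a : ℝ} (ha : 0 < a) :
    flux H (h.solC' hb A) a = h.normFlux hb A a := by
  have h0 := (h.apply_pos a).ne'
  rw [flux, solC', ← Complex.ofReal_mul]
  congr 1
  field_simp

theorem isSolution_solC (h : IsWeight c M H) (hb : 0 < b) (hA : 0 < A) :
    IsSolution b A H (kappaOne b A H) (h.solC hb A) (h.solC' hb A) := by
  have hc := h.pos
  have hfl : flux H (h.solC' hb A) =ᵐ[volume.restrict (Ioo 0 A)]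
      fun a => (h.normFlux hb A a : ℂ) := by
    filter_upwards [ae_restrict_mem measurableSet_Ioo] with a ha using h.flux_solC' hb ha.1
  have hcf : Continuous fun a => (h.normFlux hb A a : ℂ) :=
    Complex.continuous_ofReal.comp (h.continuous_normFlux hb)
  refine ⟨h.memSpace_solC hb hA (K := A) measurable_id fun a ha => ?_, h.solC hb A,
    fun a => (h.normFlux hb A a : ℂ), fun a => ((b ^ 2 * a / H a * h.normSol hb A a : ℝ) : ℂ),
    h.isContRep_solC hb, ⟨hcf.continuousOn, hfl.symm⟩, ?_, ?_, ?_, ?_, ?_, ?_⟩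
  · simp only [abs_of_pos ha.1]
    exact ha.2.le
  · refine hasWeakDeriv_of_hasACDeriv hA fun x y hx hxy _ => ?_
    exact HasACDeriv.congr hxy (h.hasACDeriv_normFlux hb hx.le hxy).ofReal
      fun a ha => h.flux_solC' hb (hx.trans_le ha.1)
  · refine memL2_of_bound (C := b ^ 2 * A / c * (4 / 3 * Real.exp (2 * b / c * A))) ?_
      fun a ha => ?_
    · have := h.measurable
      have := (h.continuous_normSol (A := A) hb).measurable
      fun_prop
    · have ha0 := ha.1
      have := h.apply_pos a
      rw [Complex.norm_real, norm_mul]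
      refine mul_le_mul ?_ (h.abs_normSol_le hb ⟨ha.1.le, ha.2.le⟩) (norm_nonneg _) (by positivity)
      rw [Real.norm_eq_abs, abs_of_nonneg (by positivity)]
      exact div_le_div₀ (by positivity) (by gcongr; exact ha.2.le) hc (h.le a)
  · refine Eventually.of_forall fun a => ?_
    simp only [solC]
    push_cast
    ring
  · have := hcf.tendsto 0
    rw [h.normFlux_zero] at this
    exact_mod_cast this.mono_left nhdsWithin_le_nhds
  · simp [solC, h.normSol_self, h.kappaOne_eq hb hA]
  · simp [solC, h.normSol_self]

/-- The boundary conditions at `A` fix both value and flux there, and Cauchy data determine the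
solution. -/
theorem ae_eq_solC_of_isSolution (h : IsWeight c M H) (hb : 0 < b) (hA : 0 < A) {g g' : ℝ → ℂ}
    (hg : IsSolution b A H (kappaOne b A H) g g') :
    g =ᵐ[volume.restrict (Ioo 0 A)] h.solC hb A := by
  obtain ⟨hgs, X, Y, k, hX, hY, hk, hk2, hode, -, hYA, hXA⟩ := hg
  rw [h.kappaOne_eq hb hA] at hYA
  have hXac := hgs.2.1.hasACDeriv hA hX (fun x hx _ =>
    integrableOn_Ioo_of_weighted (c := 1) one_pos hx (fun a ha => by rw [one_mul]) hgs.2.1.2.1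
      (hgs.2.2.integrableOn measurable_id fun a ha => ha.1.le))
  have hYac := hk.hasACDeriv hA hY fun x hx _ =>
    (MemLp.integrable one_le_two hk2).mono_measure (Measure.restrict_mono
      (Ioo_subset_Ioo_left hx.le) le_rfl)
  have hae : ∀ x, 0 < x → x ≤ A → ∀ᵐ t, t ∈ uIcc x A → 0 < t ∧
      k t = ((b ^ 2 * t / H t : ℝ) : ℂ) * X t ∧ g' t = Y t / ((t * H t : ℝ) : ℂ) := by
    intro x hx hxA
    refine ae_mem_uIcc_of_ae_mem_Ioo hxA ?_
    rw [← ae_restrict_iff' measurableSet_Ioo]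
    have hsub : Ioo x A ⊆ Ioo 0 A := Ioo_subset_Ioo_left hx.le
    filter_upwards [ae_restrict_of_ae_restrict_of_subset hsub hX.2,
      ae_restrict_of_ae_restrict_of_subset hsub hY.2,
      ae_restrict_of_ae_restrict_of_subset hsub hode, ae_restrict_mem measurableSet_Ioo]
      with t h1 h2 h3 hm
    have ht : 0 < t := hx.trans hm.1
    refine ⟨ht, ?_, ?_⟩
    · rw [h1]
      linear_combination -h3
    · rw [h2, flux, mul_div_cancel_left₀]
      exact_mod_cast (mul_pos ht (h.apply_pos t)).ne'
  -- The Wronskian with the regular solution is constant and vanishes at `A` because `κ` is the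
  -- flux-to-value ratio of that solution.
  have hW : ∀ x, 0 < x → x ≤ A → Y x * (h.sol hb x : ℂ) = X x * (h.solFlux hb x : ℂ) := by
    intro x hx hxA
    have hd := ((hYac x hx hxA).mul (h.hasACDeriv_sol hb hx.le hxA).ofReal).sub
      ((hXac x hx hxA).mul (h.hasACDeriv_solFlux hb hx.le hxA).ofReal)
    have h0 := hd.eq_of_deriv_eq_zero (by
      filter_upwards [hae x hx hxA] with t ht hm
      obtain ⟨ht0, h1, h2⟩ := ht hm
      have e1 : (t : ℂ) ≠ 0 := by exact_mod_cast ht0.ne'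
      have e2 : (H t : ℂ) ≠ 0 := by exact_mod_cast (h.apply_pos t).ne'
      rw [h1, h2]
      push_cast
      field_simp
      ring)
    have hS : (h.sol hb A : ℂ) ≠ 0 := by exact_mod_cast (h.sol_pos hb A).ne'
    rw [hYA, hXA, normFlux, Complex.ofReal_div, mul_one, div_mul_cancel₀ _ hS, one_mul,
      sub_self] at h0
    exact sub_eq_zero.1 h0
  -- A zero Wronskian means that the quotient by the nowhere vanishing `sol` has derivative zero.
  have hQ : ∀ x, 0 < x → x ≤ A → X x = h.solC hb A x := by
    intro x hx hxA
    have hd := (hXac x hx hxA).mul ((h.hasACDeriv_sol hb hx.le hxA).inv_of_one_le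
      fun _ _ => h.one_le_sol hb _).ofReal
    have h0 := hd.eq_of_deriv_eq_zero (by
      filter_upwards [hae x hx hxA] with t ht hm
      obtain ⟨ht0, -, h2⟩ := ht hm
      have e1 : (t : ℂ) ≠ 0 := by exact_mod_cast ht0.ne'
      have e2 : (H t : ℂ) ≠ 0 := by exact_mod_cast (h.apply_pos t).ne'
      have e3 : (h.sol hb t : ℂ) ≠ 0 := by exact_mod_cast (h.sol_pos hb t).ne'
      have e4 := hW t ht0 (by rw [uIcc_of_le hxA] at hm; exact hm.2)
      rw [h2]
      push_cast
      field_simp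
      linear_combination e4)
    have hS : (h.sol hb x : ℂ) ≠ 0 := by exact_mod_cast (h.sol_pos hb x).ne'
    rw [hXA, one_mul, Complex.ofReal_inv, mul_inv_eq_iff_eq_mul₀ hS, Complex.ofReal_inv] at h0
    rw [h0, solC, normSol, Complex.ofReal_div, inv_mul_eq_div]
  filter_upwards [hX.2, ae_restrict_mem measurableSet_Ioo] with t ht hm
  rw [← ht, hQ t hm.1 hm.2.le]

end IsWeight

end

end SteklovAux

/-! ### Dependence on the a.e. class of the weight, and differentiation of `κ₁`. -/

namespace SteklovAux

noncomputable section

theorem HasWeakDeriv.congr {A : ℝ} {f g k : ℝ → ℂ} (h : HasWeakDeriv A f k)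
    (hfg : f =ᵐ[volume.restrict (Ioo 0 A)] g) : HasWeakDeriv A g k := by
  refine ⟨?_, h.2.1, fun φ h1 h2 h3 => ?_⟩
  · refine (locallyIntegrableOn_iff isOpen_Ioo.isLocallyClosed).2 fun K hK hc => ?_
    exact (h.1.integrableOn_compact_subset hK hc).congr
      (ae_restrict_of_ae_restrict_of_subset hK hfg)
  · rw [← h.2.2 φ h1 h2 h3]
    refine integral_congr_ae ?_
    filter_upwards [hfg] with a ha
    rw [ha]

section congr

variable {b A : ℝ} {G H : ℝ → ℝ}

theorem energy_congr (hGH : G =ᵐ[volume.restrict (Ioo 0 A)] H) (f f' : ℝ → ℂ) :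
    energy b A G f f' = energy b A H f f' := by
  refine integral_congr_ae ?_
  filter_upwards [hGH] with a ha
  rw [ha]

theorem memWeightedL2_congr (hGH : G =ᵐ[volume.restrict (Ioo 0 A)] H) (f : ℝ → ℂ) :
    MemWeightedL2 A (fun a => a * G a) f ↔ MemWeightedL2 A (fun a => a * H a) f := by
  unfold MemWeightedL2
  rw [withDensity_congr_ae (g := fun a => ENNReal.ofReal (a * H a))]
  filter_upwards [hGH] with a ha
  rw [ha]

theorem kappaOne_congr (hGH : G =ᵐ[volume.restrict (Ioo 0 A)] H) :
    kappaOne b A G = kappaOne b A H := by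
  simp only [kappaOne, MemSpace, energy_congr hGH, memWeightedL2_congr hGH]

theorem flux_congr (hGH : G =ᵐ[volume.restrict (Ioo 0 A)] H) (f' : ℝ → ℂ) :
    flux G f' =ᵐ[volume.restrict (Ioo 0 A)] flux H f' := by
  filter_upwards [hGH] with a ha
  simp only [flux, ha]

theorem IsSolution.congr {κ : ℝ} {f f' : ℝ → ℂ} (h : IsSolution b A G κ f f')
    (hGH : G =ᵐ[volume.restrict (Ioo 0 A)] H) : IsSolution b A H κ f f' := by
  obtain ⟨hs, X, Y, k, hX, hY, hk, hk2, hode, h0, hYA, hXA⟩ := h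
  refine ⟨hs, X, Y, k, hX, ⟨hY.1, hY.2.trans (flux_congr hGH f')⟩, hk.congr (flux_congr hGH f'),
    hk2, ?_, h0, hYA, hXA⟩
  filter_upwards [hode, hGH] with a h1 h2
  rwa [← h2]

end congr

/-- The integrand of the derivative formula, polarised between two solutions. -/
def crossIntegrand (b : ℝ) (G H δ x y x' y' : ℝ → ℝ) (a : ℝ) : ℝ :=
  (y a * y' a - b ^ 2 * a ^ 2 * (x a * x' a)) * (δ a / (a * (G a * H a)))

namespace IsWeight

variable {b c M A D : ℝ} {G H δ : ℝ → ℝ}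

/-- Integrate the derivative of the Wronskian `Y_G X_H - Y_H X_G`: its value at `A` is the
difference of the two `κ`, and it vanishes at `0`. Every term of its derivative carries the factor
`1/H - 1/G`. -/
theorem kappaOne_sub (h : IsWeight c M G) (h' : IsWeight c M H) (hb : 0 < b) (hA : 0 < A) {r : ℝ}
    (hd : ∀ a, G a - H a = r * δ a) :
    kappaOne b A G - kappaOne b A H = r * ∫ a in Ioo 0 A, crossIntegrand b G H δ
      (h.normSol hb A) (h.normFlux hb A) (h'.normSol hb A) (h'.normFlux hb A) a := by
  have hW := (((h.hasACDeriv_normFlux (A := A) hb le_rfl hA.le).mul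
    (h'.hasACDeriv_normSol (A := A) hb le_rfl hA.le)).sub
    ((h'.hasACDeriv_normFlux (A := A) hb le_rfl hA.le).mul
    (h.hasACDeriv_normSol (A := A) hb le_rfl hA.le))).integral_eq
  rw [h.normFlux_zero, h'.normFlux_zero, h.normSol_self, h'.normSol_self,
    intervalIntegral.integral_of_le hA.le, integral_Ioc_eq_integral_Ioo] at hW
  rw [h.kappaOne_eq hb hA, h'.kappaOne_eq hb hA, ← integral_const_mul]
  have e : h.normFlux hb A A - h'.normFlux hb A A = h.normFlux hb A A * 1 - h'.normFlux hb A A * 1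
    - (0 * h'.normSol hb A 0 - 0 * h.normSol hb A 0) := by ring
  rw [e, ← hW]
  refine setIntegral_congr_fun measurableSet_Ioo fun a ha => ?_
  have h1 := (h.apply_pos a).ne'
  have h2 := (h'.apply_pos a).ne'
  have h3 := ha.1.ne'
  have h4 := hd a
  simp only [crossIntegrand]
  field_simp
  linear_combination (h.normFlux hb A a * h'.normFlux hb A a -
    b ^ 2 * a ^ 2 * (h.normSol hb A a * h'.normSol hb A a)) * h4

/-- Both fluxes are `O(a)`, so the bracket is `O(a²)` and absorbs the `1 / a`. The bound depends on
the weights only through `c`, hence serves as a dominating constant. -/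
theorem abs_crossIntegrand_le (h : IsWeight c M G) (h' : IsWeight c M H) (hb : 0 < b)
    (hδ : ∀ a, |δ a| ≤ D) {a : ℝ} (ha : a ∈ Ioo 0 A) :
    |crossIntegrand b G H δ (h.normSol hb A) (h.normFlux hb A)
      (h'.normSol hb A) (h'.normFlux hb A) a| ≤
      ((b ^ 2 / c * (4 / 3) * Real.exp (2 * b / c * A) / (2 * b / c)) ^ 2 +
        b ^ 2 * (4 / 3 * Real.exp (2 * b / c * A)) ^ 2) * (A * D / c ^ 2) := by
  have hc := h.pos
  have hm : a ∈ Icc 0 A := ⟨ha.1.le, ha.2.le⟩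
  have x1 := h.abs_normSol_le hb hm
  have y1 := h.abs_normFlux_le hb hm
  have x2 := h'.abs_normSol_le hb hm
  have y2 := h'.abs_normFlux_le hb hm
  have hK : 0 ≤ b ^ 2 / c * (4 / 3) * Real.exp (2 * b / c * A) / (2 * b / c) := by positivity
  have hC : 0 ≤ 4 / 3 * Real.exp (2 * b / c * A) := by positivity
  generalize b ^ 2 / c * (4 / 3) * Real.exp (2 * b / c * A) / (2 * b / c) = K at *
  generalize 4 / 3 * Real.exp (2 * b / c * A) = C at *
  have ha0 := ha.1
  have hD : 0 ≤ D := (abs_nonneg _).trans (hδ 0)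
  have e1 : |h.normFlux hb A a * h'.normFlux hb A a -
      b ^ 2 * a ^ 2 * (h.normSol hb A a * h'.normSol hb A a)| ≤ (K ^ 2 + b ^ 2 * C ^ 2) * a ^ 2 := by
    refine (abs_sub _ _).trans ?_
    rw [abs_mul, abs_mul, abs_mul (h.normSol hb A a), abs_of_nonneg (by positivity : 0 ≤ b ^ 2 * a ^ 2)]
    have := mul_le_mul y1 y2 (abs_nonneg _) (by positivity)
    have := mul_le_mul_of_nonneg_left (mul_le_mul x1 x2 (abs_nonneg _) hC)
      (by positivity : 0 ≤ b ^ 2 * a ^ 2)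
    linarith
  have hG := h.apply_pos a
  have hH := h'.apply_pos a
  have e2 : |δ a / (a * (G a * H a))| ≤ D / (a * (c * c)) := by
    rw [abs_div, abs_of_pos (by positivity : 0 < a * (G a * H a))]
    exact div_le_div₀ hD (hδ a) (by positivity) (mul_le_mul_of_nonneg_left
      (mul_le_mul (h.le a) (h'.le a) hc.le hG.le) ha0.le)
  rw [crossIntegrand, abs_mul]
  refine (mul_le_mul e1 e2 (abs_nonneg _) (by positivity)).trans ?_
  have e3 : (K ^ 2 + b ^ 2 * C ^ 2) * a ^ 2 * (D / (a * (c * c))) =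
    (K ^ 2 + b ^ 2 * C ^ 2) * (a * D / c ^ 2) := by
    field_simp
  rw [e3]
  gcongr
  exact ha.2.le

theorem measurable_crossIntegrand (h : IsWeight c M G) (h' : IsWeight c M H) (hb : 0 < b)
    (hδ : Measurable δ) :
    Measurable (crossIntegrand b G H δ (h.normSol hb A) (h.normFlux hb A)
      (h'.normSol hb A) (h'.normFlux hb A)) := by
  have := h.measurable
  have := h'.measurable
  have := (h.continuous_normSol (A := A) hb).measurable
  have := (h'.continuous_normSol (A := A) hb).measurable
  have := (h.continuous_normFlux (A := A) hb).measurable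
  have := (h'.continuous_normFlux (A := A) hb).measurable
  unfold crossIntegrand
  fun_prop

theorem integrableOn_crossIntegrand (h : IsWeight c M G) (h' : IsWeight c M H) (hb : 0 < b)
    (hδm : Measurable δ) (hδ : ∀ a, |δ a| ≤ D) :
    IntegrableOn (crossIntegrand b G H δ (h.normSol hb A) (h.normFlux hb A)
      (h'.normSol hb A) (h'.normFlux hb A)) (Ioo 0 A) :=
  Measure.integrableOn_of_bounded (by simp)
    (h.measurable_crossIntegrand h' hb hδm).aestronglyMeasurable
    ((ae_restrict_mem measurableSet_Ioo).mono fun _ ha => h.abs_crossIntegrand_le h' hb hδ ha)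

section family

variable {P : ℝ → ℝ → ℝ} {s : Set ℝ} {z : ℝ}

theorem tendsto_of_abs_sub_le {f : ℝ → ℝ} {y C : ℝ} {l : Filter ℝ} (hl : Tendsto id l (𝓝 z))
    (h : ∀ᶠ t in l, |f t - y| ≤ |t - z| * C) : Tendsto f l (𝓝 y) := by
  rw [tendsto_iff_dist_tendsto_zero]
  refine squeeze_zero' (Eventually.of_forall fun _ => dist_nonneg) h ?_
  have : Tendsto (fun t => |t - z| * C) l (𝓝 (|z - z| * C)) :=
    ((hl.sub_const z).abs).mul_const C
  simpa using this

/-- The derivative of `κ₁` along an affine family of weights. -/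
theorem hasDerivWithinAt_kappaOne (hP : ∀ t, IsWeight c M (P t)) (h : IsWeight c M H) (hz : P z = H) (hb : 0 < b) (hA : 0 < A)
    (hδm : Measurable δ) (hδ : ∀ a, |δ a| ≤ D)
    (hd : ∀ t ∈ s, ∀ a, P t a - P z a = (t - z) * δ a) :
    HasDerivWithinAt (fun t => kappaOne b A (P t))
      (∫ a in Ioo 0 A, crossIntegrand b H H δ (h.normSol hb A) (h.normFlux hb A)
        (h.normSol hb A) (h.normFlux hb A) a) s z := by
  subst hz
  have hc := (hP z).pos
  have hD : 0 ≤ D := (abs_nonneg _).trans (hδ 0)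
  rw [hasDerivWithinAt_iff_tendsto_slope]
  have hmem : ∀ᶠ t in 𝓝[s \ {z}] z, t ∈ s ∧ t ≠ z := by
    filter_upwards [self_mem_nhdsWithin] with t ht using ⟨ht.1, ht.2⟩
  have hid : Tendsto id (𝓝[s \ {z}] z) (𝓝 z) := nhdsWithin_le_nhds
  have hε : ∀ t ∈ s, ∀ a, |P t a - P z a| ≤ |t - z| * D := fun t ht a => by
    rw [hd t ht, abs_mul]
    exact mul_le_mul_of_nonneg_left (hδ a) (abs_nonneg _)
  -- The difference quotient is exactly the polarised integral, with no remainder term.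
  have hcongr : ∀ᶠ t in 𝓝[s \ {z}] z, ∫ a in Ioo 0 A, crossIntegrand b (P t) (P z) δ
      ((hP t).normSol hb A) ((hP t).normFlux hb A) ((hP z).normSol hb A) ((hP z).normFlux hb A) a =
      slope (fun t => kappaOne b A (P t)) z t := by
    filter_upwards [hmem] with t ht
    rw [slope_def_field, (hP t).kappaOne_sub (hP z) hb hA (hd t ht.1),
      mul_div_cancel_left₀ _ (sub_ne_zero.2 ht.2)]
  refine Tendsto.congr' hcongr ?_
  refine tendsto_integral_filter_of_dominated_convergence (fun _ => _)
    (Eventually.of_forall fun t =>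
      ((hP t).measurable_crossIntegrand (hP z) hb hδm).aestronglyMeasurable)
    (Eventually.of_forall fun t => (ae_restrict_mem measurableSet_Ioo).mono
      fun a ha => (hP t).abs_crossIntegrand_le (hP z) hb hδ ha) (integrable_const _) ?_
  -- Pointwise convergence of the integrand comes from the Lipschitz dependence on the weight with
  -- `ε = |t - z| D`.
  have hsol : ∀ a, Tendsto (fun t => (hP t).sol hb a) (𝓝[s \ {z}] z) (𝓝 ((hP z).sol hb a)) :=
    fun a => tendsto_of_abs_sub_le hid (C := 8 / 9 * (D / c) * Real.exp (2 * b / c * |a|)) (by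
      filter_upwards [hmem] with t ht
      exact ((hP t).abs_sol_sub_le (hP z) hb (hε t ht.1) a).trans (le_of_eq (by ring)))
  have hflux : ∀ a, Tendsto (fun t => (hP t).solFlux hb a) (𝓝[s \ {z}] z)
      (𝓝 ((hP z).solFlux hb a)) :=
    fun a => tendsto_of_abs_sub_le hid (C := D * (|a| * (20 / 9 * (b ^ 2 / c ^ 2) *
      Real.exp (2 * b / c * |a|) / (2 * b / c)))) (by
      filter_upwards [hmem] with t ht
      exact ((hP t).abs_solFlux_sub_le (hP z) hb (hε t ht.1) a).trans (le_of_eq (by ring)))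
  have hwt : ∀ a, Tendsto (fun t => P t a) (𝓝[s \ {z}] z) (𝓝 (P z a)) :=
    fun a => tendsto_of_abs_sub_le hid (C := D) (by
      filter_upwards [hmem] with t ht using hε t ht.1 a)
  filter_upwards [ae_restrict_mem measurableSet_Ioo] with a ha
  have hSA := ((hP z).sol_pos hb A).ne'
  have hx : Tendsto (fun t => (hP t).normSol hb A a) (𝓝[s \ {z}] z)
    (𝓝 ((hP z).normSol hb A a)) := (hsol a).div (hsol A) hSA
  have hy : Tendsto (fun t => (hP t).normFlux hb A a) (𝓝[s \ {z}] z)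
    (𝓝 ((hP z).normFlux hb A a)) := (hflux a).div (hsol A) hSA
  have hne : a * (P z a * P z a) ≠ 0 :=
    (mul_pos ha.1 (mul_pos ((hP z).apply_pos a) ((hP z).apply_pos a))).ne'
  exact ((hy.mul_const _).sub ((hx.mul_const _).const_mul _)).mul
    (tendsto_const_nhds.div (((hwt a).mul_const _).const_mul a) hne)

end family

end IsWeight

/-- A measurable function with values in `[c, M]` that agrees with `G` almost everywhere. -/
theorem exists_isWeight {c M A : ℝ} {G : ℝ → ℝ} (hc : 0 < c) (hcM : c ≤ M)
    (hm : AEMeasurable G (volume.restrict (Icc 0 A)))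
    (hG : ∀ᵐ a ∂(volume.restrict (Icc 0 A)), c ≤ G a ∧ G a ≤ M) :
    ∃ H, IsWeight c M H ∧ G =ᵐ[volume.restrict (Ioo 0 A)] H := by
  refine ⟨fun a => max c (min M (hm.mk G a)),
    ⟨measurable_const.max (measurable_const.min hm.measurable_mk), hc, fun a => le_max_left _ _,
      fun a => max_le hcM (min_le_left _ _)⟩,
    ae_restrict_of_ae_restrict_of_subset Ioo_subset_Icc_self ?_⟩
  filter_upwards [hG, hm.ae_eq_mk] with a h1 h2
  rw [← h2, min_eq_right h1.2, max_eq_right h1.1]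

theorem IsWeight.weightPath {c M : ℝ} {G H : ℝ → ℝ} (h : IsWeight c M G) (h' : IsWeight c M H)
    {t : ℝ} (ht : t ∈ Icc (0 : ℝ) 1) : IsWeight c M (weightPath G H t) where
  measurable := (h.measurable.const_mul _).add (h'.measurable.const_mul _)
  pos := h.pos
  le a := by
    have := mul_le_mul_of_nonneg_left (h.le a) (sub_nonneg.2 ht.2)
    have := mul_le_mul_of_nonneg_left (h'.le a) ht.1
    simp only [SteklovAux.weightPath]
    linarith
  le_upper a := by
    have := mul_le_mul_of_nonneg_left (h.le_upper a) (sub_nonneg.2 ht.2)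
    have := mul_le_mul_of_nonneg_left (h'.le_upper a) ht.1
    simp only [SteklovAux.weightPath]
    linarith

theorem weightPath_congr {A : ℝ} {G₀ G₁ H₀ H₁ : ℝ → ℝ}
    (h₀ : G₀ =ᵐ[volume.restrict (Ioo 0 A)] H₀) (h₁ : G₁ =ᵐ[volume.restrict (Ioo 0 A)] H₁) (t : ℝ) :
    weightPath G₀ G₁ t =ᵐ[volume.restrict (Ioo 0 A)] weightPath H₀ H₁ t := by
  filter_upwards [h₀, h₁] with a e₀ e₁
  simp only [weightPath, e₀, e₁]

end

end SteklovAux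

/-! ### Assembly. -/

theorem proposition2p8 (b A : ℝ) (hb : 0 < b) (hA : 0 < A) (G₀ G₁ : ℝ → ℝ)
    (hm₀ : AEMeasurable G₀ (volume.restrict (Icc 0 A)))
    (hm₁ : AEMeasurable G₁ (volume.restrict (Icc 0 A)))
    (hbd₀ : ∃ M : ℝ, ∀ a ∈ Icc 0 A, |G₀ a| ≤ M)
    (hbd₁ : ∃ M : ℝ, ∀ a ∈ Icc 0 A, |G₁ a| ≤ M)
    (hG : ∀ᵐ a ∂(volume.restrict (Icc 0 A)), 4 * Real.pi ≤ G₀ a ∧ G₀ a < G₁ a)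
    (z : ℝ) (hz : z ∈ Icc (0 : ℝ) 1) :
    ∃ f f' : ℝ → ℂ,
      SteklovAux.IsSolution b A (SteklovAux.weightPath G₀ G₁ z)
        (SteklovAux.kappaOne b A (SteklovAux.weightPath G₀ G₁ z)) f f' ∧
      (∀ g g' : ℝ → ℂ,
        SteklovAux.IsSolution b A (SteklovAux.weightPath G₀ G₁ z)
          (SteklovAux.kappaOne b A (SteklovAux.weightPath G₀ G₁ z)) g g' →
        g =ᵐ[volume.restrict (Ioo 0 A)] f) ∧
      (∀ c : ℝ, 0 < c → c ≤ A → AbsolutelyContinuousOnInterval f c A) ∧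
      (∀ a ∈ Ioo 0 A, f a ≠ 0) ∧
      IntegrableOn
        (SteklovAux.derivIntegrand b (SteklovAux.weightPath G₀ G₁ z) (fun a => G₁ a - G₀ a)
          f (SteklovAux.flux (SteklovAux.weightPath G₀ G₁ z) f')) (Ioo 0 A) ∧
      HasDerivWithinAt
        (fun t : ℝ => SteklovAux.kappaOne b A (SteklovAux.weightPath G₀ G₁ t))
        (∫ a in Ioo 0 A,
          SteklovAux.derivIntegrand b (SteklovAux.weightPath G₀ G₁ z) (fun a => G₁ a - G₀ a)
            f (SteklovAux.flux (SteklovAux.weightPath G₀ G₁ z) f') a)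
        (Icc 0 1) z := by
  open SteklovAux in
  obtain ⟨M₀, hM₀⟩ := hbd₀
  obtain ⟨M₁, hM₁⟩ := hbd₁
  have hπ : 0 < 4 * Real.pi := by positivity
  set M := max (4 * Real.pi) (max M₀ M₁)
  have hπM : 4 * Real.pi ≤ M := le_max_left _ _
  obtain ⟨H₀, hH₀, e₀⟩ := exists_isWeight hπ hπM hm₀ (by
    filter_upwards [hG, ae_restrict_mem measurableSet_Icc] with a h1 h2
    exact ⟨h1.1, (le_abs_self _).trans ((hM₀ a h2).trans
      ((le_max_left _ _).trans (le_max_right _ _)))⟩)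
  obtain ⟨H₁, hH₁, e₁⟩ := exists_isWeight hπ hπM hm₁ (by
    filter_upwards [hG, ae_restrict_mem measurableSet_Icc] with a h1 h2
    exact ⟨h1.1.trans h1.2.le, (le_abs_self _).trans ((hM₁ a h2).trans
      ((le_max_right _ _).trans (le_max_right _ _)))⟩)
  -- The parameter is clamped to `[0, 1]`, since outside it the affine path may leave `[4π, M]`; the
  -- derivative within `Icc 0 1` does not see this.
  have hP : ∀ t, IsWeight (4 * Real.pi) M (weightPath H₀ H₁ (max 0 (min t 1))) := fun t =>
    hH₀.weightPath hH₁ ⟨le_max_left _ _, max_le zero_le_one (min_le_right _ _)⟩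
  have hcl : ∀ t ∈ Icc (0 : ℝ) 1, max 0 (min t 1) = t := fun t ht => by
    rw [min_eq_left ht.2, max_eq_right ht.1]
  have hpath := fun t => weightPath_congr e₀ e₁ t
  have hW : IsWeight (4 * Real.pi) M (weightPath H₀ H₁ z) := hH₀.weightPath hH₁ hz
  have hδm : Measurable fun a => H₁ a - H₀ a := hH₁.measurable.sub hH₀.measurable
  have hδ : ∀ a, |H₁ a - H₀ a| ≤ M := fun a => by
    rw [abs_le]
    constructor <;> linarith [hH₀.le a, hH₁.le a, hH₀.le_upper a, hH₁.le_upper a]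
  -- On the diagonal the polarised integrand becomes the one of the statement, up to a null set.
  have hint : derivIntegrand b (weightPath G₀ G₁ z) (fun a => G₁ a - G₀ a) (hW.solC hb A)
      (flux (weightPath G₀ G₁ z) (hW.solC' hb A)) =ᵐ[volume.restrict (Ioo 0 A)]
      crossIntegrand b (weightPath H₀ H₁ z) (weightPath H₀ H₁ z) (fun a => H₁ a - H₀ a)
        (hW.normSol hb A) (hW.normFlux hb A) (hW.normSol hb A) (hW.normFlux hb A) := by
    filter_upwards [e₀, e₁, hpath z, flux_congr (hpath z) (hW.solC' hb A),
      ae_restrict_mem measurableSet_Ioo] with a h0 h1 h2 h3 ha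
    rw [hW.flux_solC' hb ha.1] at h3
    simp only [derivIntegrand, crossIntegrand, h0, h1, h2, h3, IsWeight.solC, Complex.norm_real,
      Real.norm_eq_abs, sq_abs]
    ring
  refine ⟨hW.solC hb A, hW.solC' hb A, ?_, fun g g' hg => ?_, fun x hx hxA => ?_, fun a ha => ?_,
    ?_, ?_⟩
  · rw [kappaOne_congr (hpath z)]
    exact (hW.isSolution_solC hb hA).congr (hpath z).symm
  · rw [kappaOne_congr (hpath z)] at hg
    exact hW.ae_eq_solC_of_isSolution hb hA (hg.congr (hpath z))
  · exact (hW.hasACDeriv_normSol hb hx.le hxA).ofReal.ac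
  · exact Complex.ofReal_ne_zero.2 (div_pos (hW.sol_pos hb a) (hW.sol_pos hb A)).ne'
  · exact (hW.integrableOn_crossIntegrand hW hb hδm hδ).congr hint.symm
  · rw [integral_congr_ae hint]
    have hderiv := IsWeight.hasDerivWithinAt_kappaOne hP hW (by rw [hcl z hz]) hb hA
      (s := Icc 0 1) (z := z) hδm hδ fun t ht a => by
        rw [hcl t ht, hcl z hz]
        simp only [weightPath]
        ring
    refine hderiv.congr (fun t ht => ?_) ?_
    · rw [hcl t ht, kappaOne_congr (hpath t)]
    · rw [hcl z hz, kappaOne_congr (hpath z)]
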